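/- **Setting.** Formulas are first-order formulas without equality, with named variables, built from atoms with $\neg,\vee,\wedge,\exists,\forall$. A formula is *rectified* if it has no vacuous quantifier, no variable has both free and bound occurrences, and no two quantifiers bind the same variable. A position is positive (negative) if it is in the scope of an even (odd) number of negations. A $\gamma$-quantifier is an $\exists$ at a positive or a $\forall$ at a negative position; every other quantifier is a $\delta$-quantifier. A quantifier is *accessible* if it is in the scope of no other quantifier. A *sentential tautology* is a quantifier-free formula that is truth-functionally valid when its atoms are read as sentential variables. **Skolemization, champ fini, expansions.** The *outer Skolemized form* $F$ of a rectified formula $A$ results from $A$ by removing each $\delta$-quantifier and replacing its variable $y$ with $y^\delta(x_1,\dots,x_m)$, where $y^\delta$ is a fresh Skolem symbol and $x_1,\dots,x_m$ are, from the outside to the inside, the variables of all $\gamma$-quantifiers in whose scope the $\delta$-quantifier occurs. The height of a term is $|f(t_1,\dots,t_m)|=1+\max\{0,|t_1|,\dots,|t_m|\}$; variables have height $1$. For $n\ge 1$, $T_n(F)$ is the set of all terms of height $<n$ built from the function symbols (including constants) and free variables of $F$, and from a fresh constant $\bullet$ if $F$ contains neither constants nor free variables. A *sub-expansion* of $F$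 with respect to a set $T$ of terms results by recursively replacing each $\exists x.\,F'$ with a disjunction $\bigvee_{t\in T'}B_t\{x\mapsto t\}$, and each $\forall x.\,F'$ with a conjunction $\bigwedge_{t\in T'}B_t\{x\mapsto t\}$, where $\emptyset\ne T'\subseteq T$ is finite and each $B_t$ is a sub-expansion of $F'$ with respect to $T$ (order and bracketing are arbitrary; $T'$ may differ from quantifier to quantifier and from copy to copy). If always $T'=T$, it is the *expansion* $F^{T}$. For $n\ge1$, $A$ *has Property C of order $n$* if $F^{T_n(F)}$ exists and is a sentential tautology. **Rules** ($A[\dots]$ is a context with one hole; premise $\Rightarrow$ conclusion). * *Generalized rule of $\gamma$-quantification*: $A[H\{x\mapsto t\}]\Rightarrow A[Qx.H]$, where $Qx.$ is an accessible $\gamma$-quantifier of the conclusion and no variable of the term $t$ is bound by a quantifier in $H$. * *Generalized rule of $\delta^-$-quantification*: $A[H]\Rightarrow A[Qy.H]$, where $Qy.$ is an accessible $\delta$-quantifier of the conclusion and $y$ does not occur free in $A[\dots]$. * *Generalized rule of $\gamma$-simplification*: $A[H\circ H']\Rightarrow A[H]$, where $H=Qy.D$ with a $\gamma$-quantifier $Qy.$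 of $A[H]$, $H'$ is $H$ or results from $H$ by renaming bound variables, and $\circ$ is $\vee$ at a positive and $\wedge$ at a negative position. **Lemma (From Property C to a Linear Derivation).** Let $A$ be a rectified first-order formula, let $F$ be its outer Skolemized form, and let $n$ be a positive natural number. If $A$ has Property C of order $n$, then there is a derivation of $A$ of the following form, in which every term that starts with a Skolem function symbol is read as an atomic variable. 1. It starts with the sentential tautology $F^{T_n(F)}$. 2. Then the generalized rules of $\gamma$- and $\delta^-$-quantification are applied repeatedly (zero or more times). 3. Then the generalized rule of $\gamma$-simplification is applied repeatedly (zero or more times). In the resulting formula, every variable bound by a $\delta$-quantifier is a Skolem term. 4. Then all bound $\delta$-variables are renamed, which yields $A$. Moreover, such a derivation also exists when, in the first step, $F^{T_n(F)}$ is replaced with any sub-expansion of $F$ with respect to $T_n(F)$ that is a sentential tautology. -/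

import Mathlib

universe u v w

namespace Herbrand


/-! ## First-order formulas with named variables -/

/-- The two quantifiers. -/
inductive Quant : Type
  | ex
  | all

/-- The two binary sentential connectives. -/
inductive Conn : Type
  | or
  | and

/-- The connective that expands a quantifier over a finite domain. -/
def Quant.conn : Quant → Conn
  | .ex => .or
  | .all => .and

/-- First-order formulas without equality over the signature `L`, with named variables from `V`,
built with negation, disjunction, conjunction, and the two quantifiers. -/
inductive Fml (L : FirstOrder.Language.{u, v}) (V : Type w) : Type (max u v w)
  | rel {k : ℕ} (R : L.Relations k) (ts : Fin k → L.Term V) : Fml L V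
  | neg (φ : Fml L V) : Fml L V
  | conn (c : Conn) (φ ψ : Fml L V) : Fml L V
  | quant (q : Quant) (x : V) (φ : Fml L V) : Fml L V

section Terms

variable {L : FirstOrder.Language.{u, v}} {V : Type w}

/-- The variables of a term. -/
def termVars : L.Term V → Set V
  | .var x => {x}
  | .func _ ts => ⋃ i, termVars (ts i)

/-- The function symbols of a term, each with its arity; constants have arity 0. -/
def termFuncs : L.Term V → Set (Σ k, L.Functions k)
  | .var _ => ∅
  | .func f ts => {⟨_, f⟩} ∪ ⋃ i, termFuncs (ts i)

/-- The height of a term; variables count as constants. -/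
def height : L.Term V → ℕ
  | .var _ => 1
  | .func _ ts => 1 + Finset.univ.sup fun i => height (ts i)

open Classical in
/-- The substitution that maps `x` to `t` and fixes all other variables. -/
noncomputable def single (x : V) (t : L.Term V) (z : V) : L.Term V :=
  if z = x then t else .var z

end Terms

namespace Fml

variable {L : FirstOrder.Language.{u, v}} {V : Type w}

/-- The variables with a free occurrence. -/
def freeVars : Fml L V → Set V
  | rel _ ts => ⋃ i, termVars (ts i)
  | neg φ => φ.freeVars
  | conn _ φ ψ => φ.freeVars ∪ ψ.freeVars
  | quant _ x φ => φ.freeVars \ {x}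

/-- The variables of the quantifiers, one entry for each quantifier occurrence. -/
def boundVars : Fml L V → List V
  | rel _ _ => []
  | neg φ => φ.boundVars
  | conn _ φ ψ => φ.boundVars ++ ψ.boundVars
  | quant _ x φ => x :: φ.boundVars

/-- The function symbols (with arities) that occur in a formula. -/
def funcs : Fml L V → Set (Σ k, L.Functions k)
  | rel _ ts => ⋃ i, termFuncs (ts i)
  | neg φ => φ.funcs
  | conn _ φ ψ => φ.funcs ∪ ψ.funcs
  | quant _ _ φ => φ.funcs

/-- Every quantifier binds at least one occurrence of its variable. -/
def NoVacuous : Fml L V → Prop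
  | rel _ _ => True
  | neg φ => φ.NoVacuous
  | conn _ φ ψ => φ.NoVacuous ∧ ψ.NoVacuous
  | quant _ x φ => x ∈ φ.freeVars ∧ φ.NoVacuous

/-- A formula is rectified if it has no vacuous quantifier, no variable has both free and bound
occurrences, and no two quantifiers bind the same variable. -/
def Rectified (φ : Fml L V) : Prop :=
  φ.NoVacuous ∧ (∀ x ∈ φ.boundVars, x ∉ φ.freeVars) ∧ φ.boundVars.Nodup

open Classical in
/-- `φ.subst x t` is `φ{x ↦ t}`: the free occurrences of `x` are replaced with `t`,
without any renaming of bound variables. -/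
noncomputable def subst (x : V) (t : L.Term V) : Fml L V → Fml L V
  | rel R ts => rel R fun i => (ts i).subst (single x t)
  | neg φ => neg (φ.subst x t)
  | conn c φ ψ => conn c (φ.subst x t) (ψ.subst x t)
  | quant q z φ => if z = x then quant q z φ else quant q z (φ.subst x t)

/-! ### Sentential tautologies -/

def QuantFree : Fml L V → Prop
  | rel _ _ => True
  | neg φ => φ.QuantFree
  | conn _ φ ψ => φ.QuantFree ∧ ψ.QuantFree
  | quant _ _ _ => False

/-- Truth-functional evaluation under a valuation `val` of the atomic formulas
(only meaningful for quantifier-free formulas). -/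
def Holds (val : ∀ k, L.Relations k → (Fin k → L.Term V) → Prop) : Fml L V → Prop
  | rel R ts => val _ R ts
  | neg φ => ¬ φ.Holds val
  | conn .or φ ψ => φ.Holds val ∨ ψ.Holds val
  | conn .and φ ψ => φ.Holds val ∧ ψ.Holds val
  | quant _ _ _ => False

/-- Sentential tautology: quantifier-free and truth-functionally valid when the atomic
subformulas are read as sentential variables. -/
def Tautology (φ : Fml L V) : Prop :=
  φ.QuantFree ∧ ∀ val, φ.Holds val

end Fml

/-! ## Polarity and contexts -/

/-- The quantifier that is a γ-quantifier at positions of the given polarity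
(`true` is positive, i.e. in the scope of an even number of negations). -/
def gammaQ : Bool → Quant
  | true => .ex
  | false => .all

/-- The quantifier that is a δ-quantifier at positions of the given polarity. -/
def deltaQ : Bool → Quant
  | true => .all
  | false => .ex

/-- The binary connective that is an α-operator at positions of the given polarity. -/
def alphaConn : Bool → Conn
  | true => .or
  | false => .and

/-- Formula contexts `A[…]` with exactly one hole. -/
inductive Ctx (L : FirstOrder.Language.{u, v}) (V : Type w) : Type (max u v w)
  | hole : Ctx L V
  | neg (C : Ctx L V) : Ctx L V
  | connL (c : Conn) (C : Ctx L V) (ψ : Fml L V) : Ctx L V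
  | connR (c : Conn) (φ : Fml L V) (C : Ctx L V) : Ctx L V
  | quant (q : Quant) (x : V) (C : Ctx L V) : Ctx L V

namespace Ctx

variable {L : FirstOrder.Language.{u, v}} {V : Type w}

/-- `C.fill H` is `C[H]`. -/
def fill : Ctx L V → Fml L V → Fml L V
  | hole, H => H
  | neg C, H => .neg (C.fill H)
  | connL c C ψ, H => .conn c (C.fill H) ψ
  | connR c φ C, H => .conn c φ (C.fill H)
  | quant q x C, H => .quant q x (C.fill H)

/-- The polarity of the hole. -/
def pos : Ctx L V → Bool
  | hole => true
  | neg C => !C.pos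
  | connL _ C _ => C.pos
  | connR _ _ C => C.pos
  | quant _ _ C => C.pos

/-- The hole is in the scope of no quantifier; a quantifier put there is accessible. -/
def Accessible : Ctx L V → Prop
  | hole => True
  | neg C => C.Accessible
  | connL _ C _ => C.Accessible
  | connR _ _ C => C.Accessible
  | quant _ _ _ => False

/-- The variables that occur free in the context, outside its hole. -/
def freeVars : Ctx L V → Set V
  | hole => ∅
  | neg C => C.freeVars
  | connL _ C ψ => C.freeVars ∪ ψ.freeVars
  | connR _ φ C => φ.freeVars ∪ C.freeVars
  | quant _ x C => C.freeVars \ {x}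

end Ctx

/-! ## The inference rules (`Rule premise conclusion`) -/

section Rules

variable {L : FirstOrder.Language.{u, v}} {V : Type w}

/-- Generalized rule of γ-quantification: from `C[H{x ↦ t}]` infer `C[Q x. H]`, where `Q x.` is
an accessible γ-quantifier and no variable of `t` is bound by a quantifier in `H`. -/
inductive GammaQuantification : Fml L V → Fml L V → Prop
  | mk (C : Ctx L V) (x : V) (H : Fml L V) (t : L.Term V) (hacc : C.Accessible)
      (ht : ∀ z ∈ termVars t, z ∉ H.boundVars) :
      GammaQuantification (C.fill (H.subst x t)) (C.fill (.quant (gammaQ C.pos) x H))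

/-- Generalized rule of δ⁻-quantification: from `C[H]` infer `C[Q y. H]`, where `Q y.` is an
accessible δ-quantifier and `y` does not occur free in the context `C`. -/
inductive DeltaQuantification : Fml L V → Fml L V → Prop
  | mk (C : Ctx L V) (y : V) (H : Fml L V) (hacc : C.Accessible) (hy : y ∉ C.freeVars) :
      DeltaQuantification (C.fill H) (C.fill (.quant (deltaQ C.pos) y H))

/-- Renaming of one bound variable, by a variable that does not occur in the scope. -/
inductive Rename : Fml L V → Fml L V → Prop
  | mk (C : Ctx L V) (q : Quant) (x z : V) (H : Fml L V)
      (hfree : z ∉ H.freeVars) (hbound : z ∉ H.boundVars) :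
      Rename (C.fill (.quant q x H)) (C.fill (.quant q z (H.subst x (.var z))))

/-- `Variant H H'`: `H'` is `H` or is obtained from it by renaming bound variables. -/
def Variant : Fml L V → Fml L V → Prop :=
  Relation.ReflTransGen Rename

/-- Renaming of one bound δ-variable, by a variable that does not occur in the scope. -/
inductive RenameDelta : Fml L V → Fml L V → Prop
  | mk (C : Ctx L V) (y z : V) (H : Fml L V)
      (hfree : z ∉ H.freeVars) (hbound : z ∉ H.boundVars) :
      RenameDelta (C.fill (.quant (deltaQ C.pos) y H))
        (C.fill (.quant (deltaQ C.pos) z (H.subst y (.var z))))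

/-- Generalized rule of γ-simplification: from `C[H ∘ H']` infer `C[H]`, where `H = Q y. D`
with a γ-quantifier `Q y.`, `H'` is a variant of `H`, and `∘` is disjunction at positive and
conjunction at negative positions. -/
inductive GammaSimplification : Fml L V → Fml L V → Prop
  | mk (C : Ctx L V) (y : V) (D H' : Fml L V)
      (hvar : Variant (.quant (gammaQ C.pos) y D) H') :
      GammaSimplification
        (C.fill (.conn (alphaConn C.pos) (.quant (gammaQ C.pos) y D) H'))
        (C.fill (.quant (gammaQ C.pos) y D))

end Rules

/-! ## Expansions -/

section Expansions

variable {L : FirstOrder.Language.{u, v}} {V : Type w}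

/-- `IsJoin c l B`: `B` joins the formulas of the non-empty list `l`, in this order and in some
bracketing, by the connective `c`. -/
inductive IsJoin (c : Conn) : List (Fml L V) → Fml L V → Prop
  | single (φ : Fml L V) : IsJoin c [φ] φ
  | join {l₁ l₂ : List (Fml L V)} {φ₁ φ₂ : Fml L V} (h₁ : IsJoin c l₁ φ₁)
      (h₂ : IsJoin c l₂ φ₂) : IsJoin c (l₁ ++ l₂) (.conn c φ₁ φ₂)

/-- `ExpandsTo ok A B`: `B` results from `A` by expanding each existential (universal) quantifier
over a finite non-empty set of terms admitted by `ok`, as a disjunction (conjunction) in any order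
and bracketing. The set is given by the duplicate-free list `l`; its member `t` contributes
`(B t){x ↦ t}`, where `B t` is an expansion of the scope. -/
inductive ExpandsTo (ok : Set (L.Term V) → Prop) : Fml L V → Fml L V → Prop
  | rel {k : ℕ} (R : L.Relations k) (ts : Fin k → L.Term V) :
      ExpandsTo ok (.rel R ts) (.rel R ts)
  | neg {A B : Fml L V} (h : ExpandsTo ok A B) : ExpandsTo ok (.neg A) (.neg B)
  | conn (c : Conn) {A₁ A₂ B₁ B₂ : Fml L V} (h₁ : ExpandsTo ok A₁ B₁)
      (h₂ : ExpandsTo ok A₂ B₂) : ExpandsTo ok (.conn c A₁ A₂) (.conn c B₁ B₂)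
  | quant (q : Quant) (x : V) (A : Fml L V) (l : List (L.Term V)) (B : L.Term V → Fml L V)
      (D : Fml L V) (hne : l ≠ []) (hnd : l.Nodup) (hok : ok {t | t ∈ l})
      (hB : ∀ t ∈ l, ExpandsTo ok A (B t))
      (hD : IsJoin q.conn (l.map fun t => (B t).subst x t) D) :
      ExpandsTo ok (.quant q x A) D

/-- `B` is a sub-expansion of `A` with respect to `T`. -/
def SubExpansion (T : Set (L.Term V)) (A B : Fml L V) : Prop :=
  ExpandsTo (fun T' => T' ⊆ T) A B

/-- `B` is the expansion of `A` with respect to `T`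
(up to the order and bracketing of the joins). -/
def Expansion (T : Set (L.Term V)) (A B : Fml L V) : Prop :=
  ExpandsTo (fun T' => T' = T) A B

end Expansions

/-! ## Skolem symbols and the reading of Skolem terms as variables -/

/-- The function symbols of `L` and one fresh constant symbol `•`. -/
inductive BulletFun (L : FirstOrder.Language.{u, v}) : ℕ → Type u
  | base {k : ℕ} (f : L.Functions k) : BulletFun L k
  | bullet : BulletFun L 0

/-- The signature `L` extended by the fresh constant symbol `•`. -/
def bulletLang (L : FirstOrder.Language.{u, v}) : FirstOrder.Language.{u, v} :=
  ⟨BulletFun L, L.Relations⟩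

/-- The function symbols of `bulletLang L` and, for each variable `y` and each arity `k`,
a fresh Skolem function symbol. -/
inductive SkolemFun (L : FirstOrder.Language.{u, v}) (V : Type w) : ℕ → Type (max u w)
  | old {k : ℕ} (f : BulletFun L k) : SkolemFun L V k
  | skolem (k : ℕ) (y : V) : SkolemFun L V k

/-- The signature `L` extended by `•` and the Skolem function symbols. -/
def skolemLang (L : FirstOrder.Language.{u, v}) (V : Type w) : FirstOrder.Language.{max u w, v} :=
  ⟨SkolemFun L V, L.Relations⟩

/-- The variables of the derivations: those of `V`, and each term that starts with a Skolem
function symbol, taken as an atomic name. -/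
inductive DVar (L : FirstOrder.Language.{u, v}) (V : Type w) : Type (max u w)
  | orig (x : V) : DVar L V
  | skolem (k : ℕ) (y : V) (ts : Fin k → (skolemLang L V).Term V) : DVar L V

section Skolem

variable {L : FirstOrder.Language.{u, v}} {V : Type w}

/-- Terms over `L` as terms over the extended signature. -/
def liftTerm : L.Term V → (skolemLang L V).Term V
  | .var x => .var x
  | .func (l := k) f ts =>
      FirstOrder.Language.Term.func (L := skolemLang L V) (l := k) (SkolemFun.old (.base f))
        fun i => liftTerm (ts i)

/-- Formulas over `L` as formulas over the extended signature. -/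
def Fml.lift : Fml L V → Fml (skolemLang L V) V
  | .rel (k := k) R ts => Fml.rel (L := skolemLang L V) (k := k) R fun i => liftTerm (ts i)
  | .neg φ => .neg φ.lift
  | .conn c φ ψ => .conn c φ.lift ψ.lift
  | .quant q x φ => .quant q x φ.lift

/-- Reads every maximal subterm that starts with a Skolem function symbol as a variable. -/
def readTerm : (skolemLang L V).Term V → (bulletLang L).Term (DVar L V)
  | .var x => .var (.orig x)
  | .func (l := k) (SkolemFun.old f) ts =>
      FirstOrder.Language.Term.func (L := bulletLang L) (l := k) f fun i => readTerm (ts i)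
  | .func (l := k) (SkolemFun.skolem _ y) ts => .var (.skolem k y ts)

/-- Reads all Skolem terms in a formula as variables. -/
def Fml.read : Fml (skolemLang L V) V → Fml (bulletLang L) (DVar L V)
  | .rel (k := k) R ts => Fml.rel (L := bulletLang L) (k := k) R fun i => readTerm (ts i)
  | .neg φ => .neg φ.read
  | .conn c φ ψ => .conn c φ.read ψ.read
  | .quant q x φ => .quant q (.orig x) φ.read

/-- The Skolem term `y(x₁, …, xₘ)` for the list `xs` of variables. -/
def skolemTerm (y : V) (xs : List V) : (skolemLang L V).Term V :=
  FirstOrder.Language.Term.func (L := skolemLang L V) (l := xs.length) (SkolemFun.skolem xs.length y)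
    fun i => .var (xs.get i)

/-- Outer Skolemization of a subformula at a position of polarity `p` in the scope of the
γ-quantifiers with the variables `xs`, listed from the outside to the inside. -/
noncomputable def skolemize : Bool → List V → Fml (skolemLang L V) V → Fml (skolemLang L V) V
  | _, _, .rel R ts => .rel R ts
  | p, xs, .neg φ => .neg (skolemize (!p) xs φ)
  | p, xs, .conn c φ ψ => .conn c (skolemize p xs φ) (skolemize p xs ψ)
  | true, xs, .quant .ex x φ => .quant .ex x (skolemize true (xs ++ [x]) φ)
  | false, xs, .quant .all x φ => .quant .all x (skolemize false (xs ++ [x]) φ)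
  | true, xs, .quant .all y φ => (skolemize true xs φ).subst y (skolemTerm y xs)
  | false, xs, .quant .ex y φ => (skolemize false xs φ).subst y (skolemTerm y xs)

/-- The outer Skolemized form of a (rectified) formula. -/
noncomputable def outerSkolem (A : Fml L V) : Fml (skolemLang L V) V :=
  skolemize true [] A.lift

/-- The fresh constant symbol `•`. -/
def bulletSymbol : Σ k, (skolemLang L V).Functions k :=
  ⟨0, SkolemFun.old .bullet⟩

/-- The champ fini of order `n` of `F`: the terms of height less than `n` that are built from the
free variables and the function symbols of `F`, and also from `•` if neither constants nor free
variables occur in `F`. -/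
def champFini (n : ℕ) (F : Fml (skolemLang L V) V) : Set ((skolemLang L V).Term V) :=
  {t | height t < n ∧ termVars t ⊆ F.freeVars ∧
    ∀ f ∈ termFuncs t, f ∈ F.funcs ∨
      f = bulletSymbol ∧ F.freeVars = ∅ ∧ ∀ g ∈ F.funcs, g.1 ≠ 0}

/-- `A` has Property C of order `n`: the expansion of its outer Skolemized form `F` with respect
to the champ fini of order `n` exists and is a sentential tautology. -/
def PropertyC (n : ℕ) (A : Fml L V) : Prop :=
  ∃ B, Expansion (champFini n (outerSkolem A)) (outerSkolem A) B ∧ B.Tautology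

/-- There is a linear derivation of `A` from `B`, with Skolem terms read as variables:
(1) it starts with the sentential tautology `B`;
(2) the generalized rules of γ- and δ⁻-quantification are applied repeatedly;
(3) the generalized rule of γ-simplification is applied repeatedly;
(4) all bound δ-variables, each of which is a Skolem term at this point, are renamed
to obtain `A`. -/
def HasLinearDerivation (B : Fml (skolemLang L V) V) (A : Fml L V) : Prop :=
  B.read.Tautology ∧
  ∃ R S : Fml (bulletLang L) (DVar L V),
    Relation.ReflTransGen (fun φ ψ => GammaQuantification φ ψ ∨ DeltaQuantification φ ψ)
      B.read R ∧
    Relation.ReflTransGen GammaSimplification R S ∧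
    (∀ (C : Ctx (bulletLang L) (DVar L V)) (y : DVar L V) (H : Fml (bulletLang L) (DVar L V)),
      S = C.fill (.quant (deltaQ C.pos) y H) → ∃ k z ts, y = .skolem k z ts) ∧
    Relation.ReflTransGen RenameDelta S A.lift.read

end Skolem

end Herbrand

namespace Herbrand

/-! ### Simultaneous substitution, expansions and contexts. -/

section Substitution

variable {L : FirstOrder.Language.{u, v}} {V : Type w}

/-! The derivation is found from its middle. A sub-expansion determines, for each copy of a
γ-quantifier, the term substituted there. Putting all quantifiers back into the copies gives a
formula whose γ-quantifiers carry these terms (`Annotated`) and whose δ-variables are the fully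
instantiated Skolem terms. Deleting its quantifiers and carrying out the substitutions returns the
sub-expansion (`flat`). Dropping only the annotations (`forget`) gives the result of the
quantification phase: once inner copies are merged, the joined copies of a γ-quantifier differ only
in the names of bound δ-variables, so γ-simplification collapses them to `A` up to these names.
`exists_annotation` builds all this by induction on `A`.

The crux is the order in which quantifiers are introduced (`WellFormed.quantification`). Read
backwards, accessible quantifiers are removed one at a time. Take a bound δ-variable `s` whose
Skolem term has least height, and the outermost quantifier on the path to it. If this is a
γ-quantifier with term `t`, then `t` is an argument of `s`; so every Skolem term read as a variable
in `t` is lower than `s`, hence not a bound δ-variable, and the side condition of the γ-rule holds.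
If it is a δ-quantifier, the eigenvariable condition follows from the invariant that no bound
δ-variable also occurs free, which each removal preserves because the bound δ-variables are pairwise
distinct.

Distinctness comes from outer Skolemization: different δ-quantifiers of `A` have different symbols,
and two copies of the same one differ in the argument contributed by some γ-quantifier above it. -/

theorem subst_congr {σ τ : V → L.Term V} (t : L.Term V) (h : ∀ z ∈ termVars t, σ z = τ z) :
    t.subst σ = t.subst τ := by
  induction t with
  | var x => exact h x rfl
  | func f ts ih =>
    simp only [FirstOrder.Language.Term.subst]
    congr 1
    funext i
    exact ih i fun z hz => h z (Set.mem_iUnion.2 ⟨i, hz⟩)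

theorem subst_eq_self {σ : V → L.Term V} (t : L.Term V) (h : ∀ z ∈ termVars t, σ z = .var z) :
    t.subst σ = t := by
  induction t with
  | var x => exact h x rfl
  | func f ts ih =>
    simp only [FirstOrder.Language.Term.subst]
    congr 1
    funext i
    exact ih i fun z hz => h z (Set.mem_iUnion.2 ⟨i, hz⟩)

theorem subst_subst (σ τ : V → L.Term V) (t : L.Term V) :
    (t.subst σ).subst τ = t.subst fun z => (σ z).subst τ := by
  induction t with
  | var x => rfl
  | func f ts ih =>
    simp only [FirstOrder.Language.Term.subst]
    congr 1
    funext i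
    exact ih i

theorem mem_termVars_subst {σ : V → L.Term V} {t : L.Term V} {v : V} :
    v ∈ termVars (t.subst σ) ↔ ∃ z ∈ termVars t, v ∈ termVars (σ z) := by
  induction t with
  | var x => simp [termVars, FirstOrder.Language.Term.subst]
  | func f ts ih =>
    simp only [FirstOrder.Language.Term.subst, termVars, Set.mem_iUnion, ih]
    tauto

theorem single_self (x : V) (t : L.Term V) : single x t x = t := if_pos rfl

theorem single_of_ne {x z : V} (t : L.Term V) (h : z ≠ x) : single x t z = .var z := if_neg h

namespace Fml

/-- Simultaneous substitution; the intended arguments are quantifier-free. -/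
def bind (σ : V → L.Term V) : Fml L V → Fml L V
  | rel R ts => rel R fun i => (ts i).subst σ
  | neg φ => neg (φ.bind σ)
  | conn c φ ψ => conn c (φ.bind σ) (ψ.bind σ)
  | quant q x φ => quant q x (φ.bind σ)

theorem bind_var (φ : Fml L V) : φ.bind .var = φ := by
  induction φ with
  | rel R ts => exact congrArg _ (funext fun i => subst_eq_self _ fun _ _ => rfl)
  | neg φ ih => simp only [bind, ih]
  | conn c φ ψ ih ih' => simp only [bind, ih, ih']
  | quant q x φ ih => simp only [bind, ih]

theorem bind_bind (σ τ : V → L.Term V) (φ : Fml L V) :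
    (φ.bind σ).bind τ = φ.bind fun z => (σ z).subst τ := by
  induction φ with
  | rel R ts => exact congrArg _ (funext fun i => subst_subst _ _ _)
  | neg φ ih => simp only [bind, ih]
  | conn c φ ψ ih ih' => simp only [bind, ih, ih']
  | quant q x φ ih => simp only [bind, ih]

theorem QuantFree.subst_eq_bind {φ : Fml L V} (h : φ.QuantFree) (x : V) (t : L.Term V) :
    φ.subst x t = φ.bind (single x t) := by
  induction φ with
  | rel R ts => rfl
  | neg φ ih => exact congrArg _ (ih h)
  | conn c φ ψ ih ih' => simp only [bind, subst, ih h.1, ih' h.2]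
  | quant q x φ ih => exact h.elim

theorem QuantFree.bind {φ : Fml L V} (h : φ.QuantFree) (σ : V → L.Term V) :
    (φ.bind σ).QuantFree := by
  induction φ with
  | rel R ts => trivial
  | neg φ ih => exact ih h
  | conn c φ ψ ih ih' => exact ⟨ih h.1, ih' h.2⟩
  | quant q x φ ih => exact h

theorem QuantFree.subst {φ : Fml L V} (h : φ.QuantFree) (x : V) (t : L.Term V) :
    (φ.subst x t).QuantFree :=
  h.subst_eq_bind x t ▸ h.bind _

theorem QuantFree.subst_bind {φ : Fml L V} (h : φ.QuantFree) (x : V) (t : L.Term V)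
    (σ : V → L.Term V) :
    (φ.subst x t).bind σ = φ.bind fun z => (single x t z).subst σ := by
  rw [h.subst_eq_bind, bind_bind]

theorem QuantFree.subst_comm {φ : Fml L V} (h : φ.QuantFree) {x y : V} {s t : L.Term V}
    (hxy : x ≠ y) (hx : x ∉ termVars s) (hy : y ∉ termVars t) :
    (φ.subst x t).subst y s = (φ.subst y s).subst x t := by
  rw [(h.subst x t).subst_eq_bind, (h.subst y s).subst_eq_bind, h.subst_bind, h.subst_bind]
  congr 1
  funext z
  have hs : s.subst (single x t) = s :=
    subst_eq_self _ fun z hz => single_of_ne _ fun e => hx (e ▸ hz)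
  have ht : t.subst (single y s) = t :=
    subst_eq_self _ fun z hz => single_of_ne _ fun e => hy (e ▸ hz)
  by_cases hzx : z = x
  · subst hzx
    rw [single_self, ht, single_of_ne _ hxy]
    exact (single_self _ _).symm
  by_cases hzy : z = y
  · subst hzy
    rw [single_self, hs, single_of_ne _ hzx]
    exact single_self _ _
  · rw [single_of_ne _ hzx, single_of_ne _ hzy]
    exact (single_of_ne _ hzy).trans (single_of_ne _ hzx).symm

theorem mem_freeVars_subst {φ : Fml L V} {x v : V} {t : L.Term V}
    (h : v ∈ (φ.subst x t).freeVars) : v ∈ φ.freeVars ∧ v ≠ x ∨ v ∈ termVars t := by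
  induction φ with
  | rel R ts =>
    obtain ⟨i, hi⟩ := Set.mem_iUnion.1 h
    obtain ⟨z, hz, hv⟩ := mem_termVars_subst.1 hi
    by_cases e : z = x
    · subst e
      exact .inr (by rwa [single_self] at hv)
    · rw [single_of_ne _ e] at hv
      obtain rfl : v = z := hv
      exact .inl ⟨Set.mem_iUnion.2 ⟨i, hz⟩, e⟩
  | neg φ ih => exact ih h
  | conn c φ ψ ih ih' =>
    rcases h with h | h
    · exact (ih h).imp_left fun h => ⟨.inl h.1, h.2⟩
    · exact (ih' h).imp_left fun h => ⟨.inr h.1, h.2⟩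
  | quant q z φ ih =>
    by_cases e : z = x
    · rw [subst, if_pos e] at h
      exact .inl ⟨h, fun h' => h.2 (h'.trans e.symm)⟩
    · rw [subst, if_neg e] at h
      exact (ih h.1).imp_left fun h' => ⟨⟨h'.1, h.2⟩, h'.2⟩

end Fml

theorem IsJoin.quantFree {c : Conn} {l : List (Fml L V)} {D : Fml L V} (h : IsJoin c l D)
    (hl : ∀ φ ∈ l, φ.QuantFree) : D.QuantFree := by
  induction h with
  | single φ => exact hl _ (by simp)
  | join _ _ ih ih' =>
    exact ⟨ih fun φ h => hl φ (by simp [h]), ih' fun φ h => hl φ (by simp [h])⟩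

theorem ExpandsTo.quantFree {ok : Set (L.Term V) → Prop} {A B : Fml L V}
    (h : ExpandsTo ok A B) : B.QuantFree := by
  induction h with
  | rel => trivial
  | neg _ ih => exact ih
  | conn c _ _ ih ih' => exact ⟨ih, ih'⟩
  | quant q x A l B D hne hnd hok hB hD ih =>
    refine hD.quantFree fun φ hφ => ?_
    obtain ⟨t, ht, rfl⟩ := List.mem_map.1 hφ
    exact (ih t ht).subst _ _

theorem ExpandsTo.mono {ok ok' : Set (L.Term V) → Prop} (hok : ∀ T, ok T → ok' T)
    {A B : Fml L V} (h : ExpandsTo ok A B) : ExpandsTo ok' A B := by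
  induction h with
  | rel => exact .rel _ _
  | neg _ ih => exact .neg ih
  | conn c _ _ ih ih' => exact .conn c ih ih'
  | quant q x A l B D hne hnd ho hB hD ih =>
    exact .quant q x A l B D hne hnd (hok _ ho) ih hD

theorem Ctx.freeVars_subset_fill {C : Ctx L V} (hC : C.Accessible) (H : Fml L V) :
    C.freeVars ⊆ (C.fill H).freeVars := by
  induction C with
  | hole => exact Set.empty_subset _
  | neg C ih => exact ih hC
  | connL c C ψ ih => exact Set.union_subset_union_left _ (ih hC)
  | connR c φ C ih => exact Set.union_subset_union_right _ (ih hC)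
  | quant q x C => exact hC.elim

theorem quant_eq_gammaQ_or_deltaQ (p : Bool) (q : Quant) : q = gammaQ p ∨ q = deltaQ p := by
  cases p <;> cases q <;> simp [gammaQ, deltaQ]

theorem gammaQ_conn (p : Bool) : (gammaQ p).conn = alphaConn p := by
  cases p <;> rfl

end Substitution

/-! ## Elimination of quantifiers -/

/-- Formulas whose γ-quantifiers are annotated with the terms to be substituted for their
variables. The kind of each quantifier is determined by its polarity. -/
inductive Annotated (L : FirstOrder.Language.{u, v}) (V : Type w) : Type (max u v w)
  | rel {k : ℕ} (R : L.Relations k) (ts : Fin k → L.Term V) : Annotated L V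
  | neg (a : Annotated L V) : Annotated L V
  | conn (c : Conn) (a b : Annotated L V) : Annotated L V
  | gamma (x : V) (t : L.Term V) (a : Annotated L V) : Annotated L V
  | delta (y : V) (a : Annotated L V) : Annotated L V

namespace Annotated

variable {L : FirstOrder.Language.{u, v}} {V : Type w}

/-- The formula that results by dropping the annotations, at a position of polarity `p`. -/
def forget : Bool → Annotated L V → Fml L V
  | _, rel R ts => .rel R ts
  | p, neg a => .neg (a.forget (!p))
  | p, conn c a b => .conn c (a.forget p) (b.forget p)
  | p, gamma x _ a => .quant (gammaQ p) x (a.forget p)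
  | p, delta y a => .quant (deltaQ p) y (a.forget p)

/-- The quantifier-free formula that results by removing all quantifiers and substituting the
annotated terms for the γ-variables. -/
noncomputable def flat : Annotated L V → Fml L V
  | rel R ts => .rel R ts
  | neg a => .neg a.flat
  | conn c a b => .conn c a.flat b.flat
  | gamma x t a => a.flat.subst x t
  | delta _ a => a.flat

/-- Substitution in the atoms. -/
noncomputable def subst (x : V) (t : L.Term V) : Annotated L V → Annotated L V
  | rel R ts => rel R fun i => (ts i).subst (single x t)
  | neg a => neg (a.subst x t)
  | conn c a b => conn c (a.subst x t) (b.subst x t)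
  | gamma z s a => gamma z s (a.subst x t)
  | delta y a => delta y (a.subst x t)

/-- The γ-variables. -/
def gammas : Annotated L V → Set V
  | rel _ _ => ∅
  | neg a => a.gammas
  | conn _ a b => a.gammas ∪ b.gammas
  | gamma x _ a => insert x a.gammas
  | delta _ a => a.gammas

/-- The δ-variables, one entry for each δ-quantifier. -/
def deltas : Annotated L V → List V
  | rel _ _ => []
  | neg a => a.deltas
  | conn _ a b => a.deltas ++ b.deltas
  | gamma _ _ a => a.deltas
  | delta y a => y :: a.deltas

/-- The number of quantifiers. -/
def size : Annotated L V → ℕ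
  | rel _ _ => 0
  | neg a => a.size
  | conn _ a b => a.size + b.size
  | gamma _ _ a => a.size + 1
  | delta _ a => a.size + 1

/-- The γ-variables belong to `Γ`, the δ-variables and the annotated terms avoid `Γ`, nested
γ-quantifiers have different variables, and the variables of the annotation of a γ-quantifier
have smaller rank than the δ-variables bound in its scope. -/
def WellFormed (Γ : Set V) (rank : V → ℕ) : Annotated L V → Prop
  | rel _ _ => True
  | neg a => a.WellFormed Γ rank
  | conn _ a b => a.WellFormed Γ rank ∧ b.WellFormed Γ rank
  | gamma x t a => x ∈ Γ ∧ (∀ v ∈ termVars t, v ∉ Γ) ∧ x ∉ a.gammas ∧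
      (∀ v ∈ termVars t, ∀ s ∈ a.deltas, rank v < rank s) ∧ a.WellFormed Γ rank
  | delta y a => y ∉ Γ ∧ a.WellFormed Γ rank

theorem flat_quantFree (a : Annotated L V) : a.flat.QuantFree := by
  induction a with
  | rel => trivial
  | neg a ih => exact ih
  | conn c a b ih ih' => exact ⟨ih, ih'⟩
  | gamma x t a ih => exact ih.subst _ _
  | delta y a ih => exact ih

theorem flat_eq_forget_of_size (a : Annotated L V) (p : Bool) (h : a.size = 0) :
    a.flat = a.forget p := by
  induction a generalizing p with
  | rel => rfl
  | neg a ih => exact congrArg _ (ih _ h)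
  | conn c a b ih ih' =>
    rw [size] at h
    rw [flat, forget, ih p (by omega), ih' p (by omega)]
  | gamma x t a ih => cases h
  | delta y a ih => cases h

/-! ### Substitution in annotated formulas. -/

section Subst

variable (x : V) (t : L.Term V) (a : Annotated L V)

theorem gammas_subst : (a.subst x t).gammas = a.gammas := by
  induction a <;> simp_all [subst, gammas]

theorem deltas_subst : (a.subst x t).deltas = a.deltas := by
  induction a <;> simp_all [subst, deltas]

theorem size_subst : (a.subst x t).size = a.size := by
  induction a <;> simp_all [subst, size]

variable {Γ : Set V} {rank : V → ℕ}

theorem wellFormed_subst : (a.subst x t).WellFormed Γ rank ↔ a.WellFormed Γ rank := by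
  induction a <;> simp_all [subst, WellFormed, gammas_subst, deltas_subst]

variable {x t a}

theorem WellFormed.gammas_subset (h : a.WellFormed Γ rank) : a.gammas ⊆ Γ := by
  induction a with
  | rel => exact Set.empty_subset _
  | neg a ih => exact ih h
  | conn c a b ih ih' => exact Set.union_subset (ih h.1) (ih' h.2)
  | gamma x t a ih => exact Set.insert_subset h.1 (ih h.2.2.2.2)
  | delta y a ih => exact ih h.2

theorem WellFormed.deltas_notMem (h : a.WellFormed Γ rank) : ∀ y ∈ a.deltas, y ∉ Γ := by
  induction a with
  | rel => simp [deltas]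
  | neg a ih => exact ih h
  | conn c a b ih ih' =>
    intro y hy
    exact (List.mem_append.1 hy).elim (ih h.1 y) (ih' h.2 y)
  | gamma x t a ih => exact ih h.2.2.2.2
  | delta y a ih =>
    intro z hz
    rcases List.mem_cons.1 hz with rfl | hz
    · exact h.1
    · exact ih h.2 z hz

theorem mem_boundVars_forget {p : Bool} {v : V} (h : v ∈ (a.forget p).boundVars) :
    v ∈ a.gammas ∨ v ∈ a.deltas := by
  induction a generalizing p with
  | rel => simp [forget, Fml.boundVars] at h
  | neg a ih => exact ih h
  | conn c a b ih ih' =>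
    rcases List.mem_append.1 h with h | h
    · exact (ih h).imp .inl (List.mem_append_left _)
    · exact (ih' h).imp .inr (List.mem_append_right _)
  | gamma x t a ih =>
    rcases List.mem_cons.1 h with rfl | h
    · exact .inl (Set.mem_insert _ _)
    · exact (ih h).imp_left (Set.mem_insert_of_mem _)
  | delta y a ih =>
    rcases List.mem_cons.1 h with rfl | h
    · exact .inr List.mem_cons_self
    · exact (ih h).imp_right (List.mem_cons_of_mem _)

theorem forget_subst (p : Bool) (hg : x ∉ a.gammas) (hd : x ∉ a.deltas) :
    (a.subst x t).forget p = (a.forget p).subst x t := by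
  induction a generalizing p with
  | rel => rfl
  | neg a ih => exact congrArg _ (ih _ hg hd)
  | conn c a b ih ih' =>
    simp only [gammas, deltas, Set.mem_union, List.mem_append, not_or] at hg hd
    simp only [subst, forget, Fml.subst, ih p hg.1 hd.1, ih' p hg.2 hd.2]
  | gamma z s a ih =>
    simp only [gammas, deltas, Set.mem_insert_iff, not_or] at hg hd
    simp only [subst, forget, Fml.subst, ih p hg.2 hd, if_neg (Ne.symm hg.1)]
  | delta y a ih =>
    simp only [gammas, deltas, List.mem_cons, not_or] at hg hd
    simp only [subst, forget, Fml.subst, ih p hg hd.2, if_neg (Ne.symm hd.1)]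

/-- The substitutions performed by `flat` for the inner γ-quantifiers commute with `x ↦ t`: they
concern other variables, and neither `t` nor the annotations contain γ-variables. This also
justifies substituting in the atoms only. -/
theorem WellFormed.flat_subst (h : a.WellFormed Γ rank) (hx : x ∈ Γ)
    (ht : ∀ v ∈ termVars t, v ∉ Γ) (hg : x ∉ a.gammas) :
    (a.subst x t).flat = a.flat.subst x t := by
  induction a with
  | rel => rfl
  | neg a ih => exact congrArg _ (ih h hg)
  | conn c a b ih ih' =>
    simp only [gammas, Set.mem_union, not_or] at hg
    simp only [subst, flat, Fml.subst, ih h.1 hg.1, ih' h.2 hg.2]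
  | gamma z s a ih =>
    simp only [gammas, Set.mem_insert_iff, not_or] at hg
    obtain ⟨hz, hs, -, -, ha⟩ := h
    simp only [subst, flat, ih ha hg.2]
    exact a.flat_quantFree.subst_comm hg.1 (fun h => hs _ h hx) fun h => ht _ h hz
  | delta y a ih => exact ih h.2 hg

end Subst

/-- `Step D a b`: one accessible quantifier of `a` is removed in `b`; if it is a γ-quantifier then
the variables of its annotation do not belong to `D`. -/
inductive Step (D : Set V) : Annotated L V → Annotated L V → Prop
  | gamma (x : V) (t : L.Term V) (a : Annotated L V) (ht : ∀ v ∈ termVars t, v ∉ D) :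
      Step D (.gamma x t a) (a.subst x t)
  | delta (y : V) (a : Annotated L V) : Step D (.delta y a) a
  | neg {a b : Annotated L V} (h : Step D a b) : Step D (.neg a) (.neg b)
  | connL (c : Conn) {a b : Annotated L V} (d : Annotated L V) (h : Step D a b) :
      Step D (.conn c a d) (.conn c b d)
  | connR (c : Conn) (d : Annotated L V) {a b : Annotated L V} (h : Step D a b) :
      Step D (.conn c d a) (.conn c d b)

/-! ### Removal of accessible quantifiers in a suitable order. -/

section Steps

variable {D Γ : Set V} {rank : V → ℕ} {a b : Annotated L V}

/-- The outermost quantifier on the path to the quantifier of `s` can be removed. If it is a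
γ-quantifier, the variables of its annotation rank below `s`, hence below all of `D`. -/
theorem exists_step_of_mem_deltas (h : a.WellFormed Γ rank) {s : V} (hs : s ∈ a.deltas)
    (hD : ∀ y ∈ D, rank s ≤ rank y) : ∃ b, Step D a b := by
  induction a with
  | rel => cases hs
  | neg a ih => exact (ih h hs).imp' _ fun _ => .neg
  | conn c a b ih ih' =>
    rcases List.mem_append.1 hs with hs | hs
    · exact (ih h.1 hs).imp' _ fun _ => .connL c b
    · exact (ih' h.2 hs).imp' _ fun _ => .connR c a
  | gamma x t a ih =>
    exact ⟨_, .gamma x t a fun v hv hvD => (h.2.2.2.1 v hv s hs).not_ge (hD v hvD)⟩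
  | delta y a ih => exact ⟨_, .delta y a⟩

theorem exists_step_of_size_ne_zero (h : a.size ≠ 0) : ∃ b, Step ∅ a b := by
  induction a with
  | rel => exact (h rfl).elim
  | neg a ih => exact (ih h).imp' _ fun _ => .neg
  | conn c a b ih ih' =>
    by_cases ha : a.size = 0
    · exact (ih' fun hb => h (by rw [size, ha, hb])).imp' _ fun _ => .connR c a
    · exact (ih ha).imp' _ fun _ => .connL c b
  | gamma x t a ih => exact ⟨_, .gamma x t a fun _ _ h => h⟩
  | delta y a ih => exact ⟨_, .delta y a⟩

theorem Step.size_lt (h : Step D a b) : b.size < a.size := by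
  induction h <;> simp_all [size, size_subst]

theorem Step.deltas_sublist (h : Step D a b) : b.deltas.Sublist a.deltas := by
  induction h with
  | gamma x t a ht => exact (deltas_subst x t a).symm ▸ List.Sublist.refl _
  | delta y a => exact List.sublist_cons_self _ _
  | neg _ ih => exact ih
  | connL c d _ ih => exact ih.append_right _
  | connR c d _ ih => exact ih.append_left _

theorem Step.wellFormed (h : Step D a b) (ha : a.WellFormed Γ rank) : b.WellFormed Γ rank := by
  induction h with
  | gamma x t a ht => exact (wellFormed_subst x t a).2 ha.2.2.2.2
  | delta y a => exact ha.2
  | neg _ ih => exact ih ha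
  | connL c d _ ih => exact ⟨ih ha.1, ha.2⟩
  | connR c d _ ih => exact ⟨ha.1, ih ha.2⟩

theorem Step.flat_eq (h : Step D a b) (ha : a.WellFormed Γ rank) : b.flat = a.flat := by
  induction h with
  | gamma x t a ht => exact ha.2.2.2.2.flat_subst ha.1 ha.2.1 ha.2.2.1
  | delta y a => rfl
  | neg _ ih => exact congrArg Fml.neg (ih ha)
  | connL c d _ ih => simp only [flat, ih ha.1]
  | connR c d _ ih => simp only [flat, ih ha.2]

/-- A removal frees only variables of an annotation, which avoid `D`, or the removed δ-variable,
which by distinctness is no longer bound. With `D` the set of all bound δ-variables, no variable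
that is still δ-bound becomes free. -/
theorem Step.mem_freeVars (h : Step D a b) (ha : a.WellFormed Γ rank) (hnd : a.deltas.Nodup)
    (p : Bool) {v : V} (hv : v ∈ (b.forget p).freeVars) :
    v ∈ (a.forget p).freeVars ∨ v ∉ D ∨ v ∈ a.deltas ∧ v ∉ b.deltas := by
  induction h generalizing p with
  | gamma x t a ht =>
    rw [forget_subst p ha.2.2.1 fun h => ha.2.2.2.2.deltas_notMem _ h ha.1] at hv
    rcases Fml.mem_freeVars_subst hv with hv | hv
    · exact .inl hv
    · exact .inr (.inl (ht v hv))
  | delta y a =>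
    by_cases e : v = y
    · subst e
      exact .inr (.inr ⟨List.mem_cons_self, (List.nodup_cons.1 hnd).1⟩)
    · exact .inl ⟨hv, e⟩
  | neg _ ih => exact ih ha hnd _ hv
  | connL c d _ ih =>
    rw [deltas, List.nodup_append'] at hnd
    rcases hv with hv | hv
    · refine (ih ha.1 hnd.1 p hv).imp .inl (.imp_right fun h => ?_)
      simp only [deltas, List.mem_append, not_or]
      exact ⟨.inl h.1, h.2, hnd.2.2 h.1⟩
    · exact .inl (.inr hv)
  | connR c d _ ih =>
    rw [deltas, List.nodup_append'] at hnd
    rcases hv with hv | hv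
    · exact .inl (.inl hv)
    · refine (ih ha.2 hnd.2.1 p hv).imp .inr (.imp_right fun h => ?_)
      simp only [deltas, List.mem_append, not_or]
      exact ⟨.inr h.1, fun h' => hnd.2.2 h' h.1, h.2⟩

/-- Turns a removal into the data of a rule instance read backwards. The term avoids the γ-variables
in its scope by well-formedness and the δ-variables because they lie in `D`. Here `p == C.pos` is
the polarity of the hole when the whole formula stands at polarity `p`. -/
theorem Step.exists_ctx (h : Step D a b) (ha : a.WellFormed Γ rank) (hD : ∀ y ∈ a.deltas, y ∈ D)
    (p : Bool) : ∃ C : Ctx L V, C.Accessible ∧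
      ((∃ x H t, (∀ z ∈ termVars t, z ∉ H.boundVars) ∧ b.forget p = C.fill (H.subst x t) ∧
          a.forget p = C.fill (.quant (gammaQ (p == C.pos)) x H)) ∨
        ∃ y H, y ∈ a.deltas ∧ b.forget p = C.fill H ∧
          a.forget p = C.fill (.quant (deltaQ (p == C.pos)) y H)) := by
  induction h generalizing p with
  | gamma x t a ht =>
    obtain ⟨hx, htΓ, hxa, -, ha⟩ := ha
    refine ⟨.hole, trivial, .inl ⟨x, a.forget p, t, fun z hz hb => ?_, ?_, ?_⟩⟩
    · rcases mem_boundVars_forget hb with hb | hb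
      · exact htΓ z hz (ha.gammas_subset hb)
      · exact ht z hz (hD z hb)
    · exact forget_subst p hxa fun h => ha.deltas_notMem _ h hx
    · cases p <;> rfl
  | delta y a =>
    exact ⟨.hole, trivial, .inr ⟨y, a.forget p, List.mem_cons_self, rfl, by cases p <;> rfl⟩⟩
  | neg _ ih =>
    obtain ⟨C, hC, h⟩ := ih ha hD (!p)
    have e : (p == C.neg.pos) = ((!p) == C.pos) := by
      simp only [Ctx.pos]
      cases p <;> cases C.pos <;> rfl
    refine ⟨C.neg, hC, h.imp ?_ ?_⟩
    · rintro ⟨x, H, t, ht, h₁, h₂⟩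
      exact ⟨x, H, t, ht, congrArg _ h₁, e ▸ congrArg Fml.neg h₂⟩
    · rintro ⟨y, H, hy, h₁, h₂⟩
      exact ⟨y, H, hy, congrArg _ h₁, e ▸ congrArg Fml.neg h₂⟩
  | connL c d _ ih =>
    obtain ⟨C, hC, h⟩ := ih ha.1 (fun y hy => hD y (List.mem_append_left _ hy)) p
    refine ⟨.connL c C (d.forget p), hC, h.imp ?_ ?_⟩
    · rintro ⟨x, H, t, ht, h₁, h₂⟩
      exact ⟨x, H, t, ht, congrArg (Fml.conn c · _) h₁, congrArg (Fml.conn c · _) h₂⟩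
    · rintro ⟨y, H, hy, h₁, h₂⟩
      exact ⟨y, H, List.mem_append_left _ hy, congrArg (Fml.conn c · _) h₁,
        congrArg (Fml.conn c · _) h₂⟩
  | connR c d _ ih =>
    obtain ⟨C, hC, h⟩ := ih ha.2 (fun y hy => hD y (List.mem_append_right _ hy)) p
    refine ⟨.connR c (d.forget p) C, hC, h.imp ?_ ?_⟩
    · rintro ⟨x, H, t, ht, h₁, h₂⟩
      exact ⟨x, H, t, ht, congrArg (Fml.conn c _) h₁, congrArg (Fml.conn c _) h₂⟩
    · rintro ⟨y, H, hy, h₁, h₂⟩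
      exact ⟨y, H, List.mem_append_right _ hy, congrArg (Fml.conn c _) h₁,
        congrArg (Fml.conn c _) h₂⟩

/-- The quantifiers of a well-formed annotated formula can be introduced one after the other. -/
theorem WellFormed.quantification (ha : a.WellFormed Γ rank) (hnd : a.deltas.Nodup)
    (hfree : ∀ y ∈ a.deltas, y ∉ (a.forget true).freeVars) :
    Relation.ReflTransGen (fun φ ψ => GammaQuantification φ ψ ∨ DeltaQuantification φ ψ)
      a.flat (a.forget true) := by
  induction hn : a.size using Nat.strong_induction_on generalizing a with
  | _ n ih =>
  by_cases h0 : a.size = 0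
  · rw [a.flat_eq_forget_of_size true h0]
  -- `D` is the set of all bound δ-variables. If there are any, one of minimal rank leads to a
  -- removable quantifier; otherwise every γ-quantifier may be removed.
  obtain ⟨D, hD, b, hab⟩ : ∃ D : Set V, (∀ y, y ∈ a.deltas ↔ y ∈ D) ∧ ∃ b, Step D a b := by
    by_cases hne : a.deltas = []
    · exact ⟨∅, by simp [hne], exists_step_of_size_ne_zero h0⟩
    · obtain ⟨s, hs, hmin⟩ := Set.exists_min_image {y | y ∈ a.deltas} rank a.deltas.finite_toSet
        (List.exists_mem_of_ne_nil _ hne)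
      exact ⟨{y | y ∈ a.deltas}, fun _ => Iff.rfl, exists_step_of_mem_deltas ha hs hmin⟩
  have hb := ih b.size (hn ▸ hab.size_lt) (hab.wellFormed ha) (hab.deltas_sublist.nodup hnd)
    (fun y hy hyb => by
      have hya := hab.deltas_sublist.subset hy
      rcases hab.mem_freeVars ha hnd true hyb with h | h | h
      · exact hfree y hya h
      · exact h ((hD y).1 hya)
      · exact h.2 hy) rfl
  rw [hab.flat_eq ha] at hb
  refine hb.tail ?_
  obtain ⟨C, hC, ⟨x, H, t, ht, h₁, h₂⟩ | ⟨y, H, hy, h₁, h₂⟩⟩ :=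
    hab.exists_ctx ha (fun y => (hD y).1) true
  · rw [h₁, h₂]
    exact .inl (by simpa using GammaQuantification.mk C x H t hC ht)
  · rw [h₁, h₂]
    -- Eigenvariable condition: an accessible context binds nothing at its hole, so `y` free in `C`
    -- would be free in the whole formula.
    have hyC : y ∉ C.freeVars := fun h =>
      hfree y hy (h₂ ▸ Ctx.freeVars_subset_fill hC _ h)
    exact .inr (by simpa using DeltaQuantification.mk C y H hC hyC)

end Steps

end Annotated

end Herbrand

namespace Herbrand

/-! ## Naming of bound variables -/

section Naming

variable {L : FirstOrder.Language.{u, v}} {V : Type w}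

/-- The variable of `V` from which a variable of the derivations is obtained. -/
def DVar.base : DVar L V → V
  | .orig x => x
  | .skolem _ y _ => y

/-- The term that results by naming the variables according to `ν`. -/
def nameTerm (ν : V → DVar L V) : L.Term V → (bulletLang L).Term (DVar L V)
  | .var x => .var (ν x)
  | .func (l := k) f ts =>
      FirstOrder.Language.Term.func (L := bulletLang L) (l := k) (.base f) fun i =>
        nameTerm ν (ts i)

/-- The formula that results by naming all variables, free and bound, according to `ν`. -/
def Fml.name (ν : V → DVar L V) : Fml L V → Fml (bulletLang L) (DVar L V)
  | .rel (k := k) R ts => Fml.rel (L := bulletLang L) (k := k) R fun i => nameTerm ν (ts i)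
  | .neg φ => .neg (φ.name ν)
  | .conn c φ ψ => .conn c (φ.name ν) (ψ.name ν)
  | .quant q x φ => .quant q (ν x) (φ.name ν)

/-- The γ-variables satisfy `P` and the δ-variables satisfy `Q`, at a position of the given
polarity. -/
def Fml.ForQuants (P Q : V → Prop) : Bool → Fml L V → Prop
  | _, .rel _ _ => True
  | p, .neg φ => φ.ForQuants P Q (!p)
  | p, .conn _ φ ψ => φ.ForQuants P Q p ∧ ψ.ForQuants P Q p
  | true, .quant .ex x φ => P x ∧ φ.ForQuants P Q true
  | false, .quant .all x φ => P x ∧ φ.ForQuants P Q false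
  | true, .quant .all y φ => Q y ∧ φ.ForQuants P Q true
  | false, .quant .ex y φ => Q y ∧ φ.ForQuants P Q false

theorem Fml.forQuants_gamma {P Q : V → Prop} {p : Bool} {x : V} {φ : Fml L V} :
    (Fml.quant (gammaQ p) x φ).ForQuants P Q p ↔ P x ∧ φ.ForQuants P Q p := by
  cases p <;> rfl

theorem Fml.forQuants_delta {P Q : V → Prop} {p : Bool} {y : V} {φ : Fml L V} :
    (Fml.quant (deltaQ p) y φ).ForQuants P Q p ↔ Q y ∧ φ.ForQuants P Q p := by
  cases p <;> rfl

theorem Fml.ForQuants.imp {P Q P' Q' : V → Prop} {p : Bool} {φ : Fml L V}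
    (h : φ.ForQuants P Q p) (hP : ∀ x ∈ φ.boundVars, P x → P' x)
    (hQ : ∀ x ∈ φ.boundVars, Q x → Q' x) : φ.ForQuants P' Q' p := by
  induction φ generalizing p with
  | rel => trivial
  | neg φ ih => exact ih h hP hQ
  | conn c φ ψ ih ih' =>
    exact ⟨ih h.1 (fun x hx => hP x (List.mem_append_left _ hx))
      fun x hx => hQ x (List.mem_append_left _ hx),
      ih' h.2 (fun x hx => hP x (List.mem_append_right _ hx))
      fun x hx => hQ x (List.mem_append_right _ hx)⟩
  | quant q x φ ih =>
    have hφ := fun h => ih (p := p) h (fun x hx => hP x (List.mem_cons_of_mem _ hx))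
      fun x hx => hQ x (List.mem_cons_of_mem _ hx)
    rcases quant_eq_gammaQ_or_deltaQ p q with rfl | rfl
    · rw [forQuants_gamma] at h ⊢
      exact ⟨hP x List.mem_cons_self h.1, hφ h.2⟩
    · rw [forQuants_delta] at h ⊢
      exact ⟨hQ x List.mem_cons_self h.1, hφ h.2⟩

theorem Fml.ForQuants.and {P Q P' Q' : V → Prop} {p : Bool} {φ : Fml L V}
    (h : φ.ForQuants P Q p) (h' : φ.ForQuants P' Q' p) :
    φ.ForQuants (fun x => P x ∧ P' x) (fun x => Q x ∧ Q' x) p := by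
  induction φ generalizing p with
  | rel => trivial
  | neg φ ih => exact ih h h'
  | conn c φ ψ ih ih' => exact ⟨ih h.1 h'.1, ih' h.2 h'.2⟩
  | quant q x φ ih =>
    rcases quant_eq_gammaQ_or_deltaQ p q with rfl | rfl
    · rw [forQuants_gamma] at *
      exact ⟨⟨h.1, h'.1⟩, ih h.2 h'.2⟩
    · rw [forQuants_delta] at *
      exact ⟨⟨h.1, h'.1⟩, ih h.2 h'.2⟩

theorem nameTerm_congr {ν ν' : V → DVar L V} (t : L.Term V)
    (h : ∀ z ∈ termVars t, ν z = ν' z) : nameTerm ν t = nameTerm ν' t := by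
  induction t with
  | var x => exact congrArg _ (h x rfl)
  | func f ts ih =>
    simp only [nameTerm]
    congr 1
    funext i
    exact ih i fun z hz => h z (Set.mem_iUnion.2 ⟨i, hz⟩)

theorem mem_termVars_nameTerm {ν : V → DVar L V} {t : L.Term V} {v : DVar L V}
    (h : v ∈ termVars (nameTerm ν t)) : ∃ z ∈ termVars t, v = ν z := by
  induction t with
  | var x => exact ⟨x, rfl, h⟩
  | func f ts ih =>
    obtain ⟨i, hi⟩ := Set.mem_iUnion.1 h
    obtain ⟨z, hz, e⟩ := ih i hi
    exact ⟨z, Set.mem_iUnion.2 ⟨i, hz⟩, e⟩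

theorem readTerm_liftTerm (t : L.Term V) : readTerm (liftTerm t) = nameTerm .orig t := by
  induction t with
  | var x => rfl
  | func f ts ih =>
    simp only [liftTerm, readTerm, nameTerm, ih]

namespace Fml

theorem read_lift (φ : Fml L V) : φ.lift.read = φ.name .orig := by
  induction φ with
  | rel R ts => simp only [lift, read, name, readTerm_liftTerm]
  | neg φ ih => simp only [lift, read, name, ih]
  | conn c φ ψ ih ih' => simp only [lift, read, name, ih, ih']
  | quant q x φ ih => simp only [lift, read, name, ih]

theorem name_congr {ν ν' : V → DVar L V} (φ : Fml L V) (hf : ∀ z ∈ φ.freeVars, ν z = ν' z)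
    (hb : ∀ z ∈ φ.boundVars, ν z = ν' z) : φ.name ν = φ.name ν' := by
  induction φ with
  | rel R ts =>
    simp only [name]
    congr 1
    funext i
    exact nameTerm_congr _ fun z hz => hf z (Set.mem_iUnion.2 ⟨i, hz⟩)
  | neg φ ih => exact congrArg _ (ih hf hb)
  | conn c φ ψ ih ih' =>
    simp only [name]
    rw [ih (fun z hz => hf z (.inl hz)) fun z hz => hb z (List.mem_append_left _ hz),
      ih' (fun z hz => hf z (.inr hz)) fun z hz => hb z (List.mem_append_right _ hz)]
  | quant q x φ ih =>
    have hx := hb x List.mem_cons_self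
    simp only [name]
    rw [hx, ih (fun z hz => ?_) fun z hz => hb z (List.mem_cons_of_mem _ hz)]
    by_cases e : z = x
    · rw [e, hx]
    · exact hf z ⟨hz, e⟩

theorem mem_freeVars_name {ν : V → DVar L V} {φ : Fml L V} {v : DVar L V}
    (h : v ∈ (φ.name ν).freeVars) : ∃ z ∈ φ.freeVars, v = ν z := by
  induction φ with
  | rel R ts =>
    obtain ⟨i, hi⟩ := Set.mem_iUnion.1 h
    obtain ⟨z, hz, e⟩ := mem_termVars_nameTerm hi
    exact ⟨z, Set.mem_iUnion.2 ⟨i, hz⟩, e⟩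
  | neg φ ih => exact ih h
  | conn c φ ψ ih ih' =>
    rcases h with h | h
    · obtain ⟨z, hz, e⟩ := ih h
      exact ⟨z, .inl hz, e⟩
    · obtain ⟨z, hz, e⟩ := ih' h
      exact ⟨z, .inr hz, e⟩
  | quant q x φ ih =>
    obtain ⟨z, hz, rfl⟩ := ih h.1
    exact ⟨z, ⟨hz, fun e => h.2 (congrArg ν e)⟩, rfl⟩

theorem boundVars_name (ν : V → DVar L V) (φ : Fml L V) :
    (φ.name ν).boundVars = φ.boundVars.map ν := by
  induction φ <;> simp_all [name, boundVars]

-- Injectivity of `ν` ensures that substituting for the name of `y` affects no other variable.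
open Classical in
theorem name_subst {ν : V → DVar L V} (hν : ν.Injective) {y : V} (w : DVar L V) {φ : Fml L V}
    (hy : y ∉ φ.boundVars) :
    (φ.name ν).subst (ν y) (.var w) = φ.name (Function.update ν y w) := by
  induction φ with
  | rel R ts =>
    simp only [name, subst]
    congr 1
    funext i
    induction ts i with
    | var x =>
      by_cases e : x = y
      · subst e
        simp [nameTerm, FirstOrder.Language.Term.subst, single]
      · simp [nameTerm, FirstOrder.Language.Term.subst, single, e, hν.eq_iff]
    | func f us ih => simp only [nameTerm, FirstOrder.Language.Term.subst, ih]
  | neg φ ih => exact congrArg _ (ih hy)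
  | conn c φ ψ ih ih' =>
    simp only [boundVars, List.mem_append, not_or] at hy
    simp only [name, subst, ih hy.1, ih' hy.2]
  | quant q x φ ih =>
    simp only [boundVars, List.mem_cons, not_or] at hy
    have hx : x ≠ y := Ne.symm hy.1
    simp only [name, subst, ih hy.2, if_neg (hν.ne hx), Function.update_of_ne hx]

end Fml

/-- Renaming of one bound δ-variable in a formula at a position of polarity `p`. -/
inductive PolarRename {L : FirstOrder.Language.{u, v}} {V : Type w} (p : Bool) :
    Fml L V → Fml L V → Prop
  | mk (C : Ctx L V) (y z : V) (H : Fml L V)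
      (hfree : z ∉ H.freeVars) (hbound : z ∉ H.boundVars) :
      PolarRename p (C.fill (.quant (deltaQ (p == C.pos)) y H))
        (C.fill (.quant (deltaQ (p == C.pos)) z (H.subst y (.var z))))

theorem beq_pos_neg (p : Bool) (C : Ctx L V) : (p == C.neg.pos) = ((!p) == C.pos) := by
  simp only [Ctx.pos]
  cases p <;> cases C.pos <;> rfl

/-! ### Renaming relative to a polarity, for use under negations. -/

section PolarRename

variable {φ ψ : Fml L V} {p : Bool}

theorem PolarRename.rename (h : PolarRename p φ ψ) : Rename φ ψ := by
  obtain ⟨C, y, z, H, hf, hb⟩ := h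
  exact .mk C _ y z H hf hb

theorem PolarRename.renameDelta (h : PolarRename true φ ψ) : RenameDelta φ ψ := by
  obtain ⟨C, y, z, H, hf, hb⟩ := h
  simpa using RenameDelta.mk C y z H hf hb

theorem PolarRename.neg (h : PolarRename (!p) φ ψ) : PolarRename p (.neg φ) (.neg ψ) := by
  obtain ⟨C, y, z, H, hf, hb⟩ := h
  rw [← beq_pos_neg]
  exact .mk C.neg y z H hf hb

theorem PolarRename.connL (c : Conn) (χ : Fml L V) (h : PolarRename p φ ψ) :
    PolarRename p (.conn c φ χ) (.conn c ψ χ) := by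
  obtain ⟨C, y, z, H, hf, hb⟩ := h
  exact .mk (.connL c C χ) y z H hf hb

theorem PolarRename.connR (c : Conn) (χ : Fml L V) (h : PolarRename p φ ψ) :
    PolarRename p (.conn c χ φ) (.conn c χ ψ) := by
  obtain ⟨C, y, z, H, hf, hb⟩ := h
  exact .mk (.connR c χ C) y z H hf hb

theorem PolarRename.quant (q : Quant) (x : V) (h : PolarRename p φ ψ) :
    PolarRename p (.quant q x φ) (.quant q x ψ) := by
  obtain ⟨C, y, z, H, hf, hb⟩ := h
  exact .mk (.quant q x C) y z H hf hb

theorem PolarRename.delta {y z : V} (hfree : z ∉ φ.freeVars) (hbound : z ∉ φ.boundVars) :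
    PolarRename p (.quant (deltaQ p) y φ) (.quant (deltaQ p) z (φ.subst y (.var z))) := by
  have h := PolarRename.mk (p := p) .hole y z φ hfree hbound
  have e : (p == (Ctx.hole : Ctx L V).pos) = p := by cases p <;> rfl
  rwa [e] at h

end PolarRename

/-- Two namings of a formula that differ only in the names of δ-variables are linked by renamings
of bound δ-variables, if the names determine the named variables. -/
theorem polarRename_name {φ : Fml L V} (hnd : φ.boundVars.Nodup) {p : Bool} {ν ν' : V → DVar L V}
    (hν : ∀ z, (ν z).base = z) (hν' : ∀ z, (ν' z).base = z)
    (hγ : φ.ForQuants (fun x => ν x = ν' x) (fun _ => True) p)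
    (hf : ∀ z ∈ φ.freeVars, ν z = ν' z) :
    Relation.ReflTransGen (PolarRename p) (φ.name ν) (φ.name ν') := by
  classical
  induction φ generalizing p ν with
  | rel R ts => rw [Fml.name_congr _ hf (by simp [Fml.boundVars])]
  | neg φ ih => exact (ih hnd hν hγ hf).lift _ fun _ _ => .neg
  | conn c φ ψ ih ih' =>
    rw [Fml.boundVars, List.nodup_append'] at hnd
    exact ((ih hnd.1 hν hγ.1 fun z hz => hf z (.inl hz)).lift (Fml.conn c · _)
      fun _ _ => .connL c _).trans
      ((ih' hnd.2.1 hν hγ.2 fun z hz => hf z (.inr hz)).lift (Fml.conn c _)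
      fun _ _ => .connR c _)
  | quant q x φ ih =>
    rw [Fml.boundVars, List.nodup_cons] at hnd
    by_cases e : ν x = ν' x
    · have hφ : φ.ForQuants (fun x => ν x = ν' x) (fun _ => True) p := by
        rcases quant_eq_gammaQ_or_deltaQ p q with rfl | rfl
        · exact (Fml.forQuants_gamma.1 hγ).2
        · exact (Fml.forQuants_delta.1 hγ).2
      simp only [Fml.name, e]
      refine (ih hnd.2 hν hφ fun z hz => ?_).lift _ fun _ _ => .quant q _
      by_cases e' : z = x
      · rw [e', e]
      · exact hf z ⟨hz, e'⟩
    · rcases quant_eq_gammaQ_or_deltaQ p q with rfl | rfl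
      · exact (e (Fml.forQuants_gamma.1 hγ).1).elim
      rw [Fml.forQuants_delta] at hγ
      -- The new name is fresh: a name determines its variable, so a clash could only be with the
      -- name of `x` itself, which is different.
      have hne : ∀ z, ν' x ≠ ν z := fun z h => by
        have h' := congrArg DVar.base h
        rw [hν, hν'] at h'
        exact e (h' ▸ h.symm)
      have hν₁ : ∀ z, (Function.update ν x (ν' x) z).base = z := fun z => by
        by_cases e' : z = x
        · rw [e', Function.update_self, hν']
        · rw [Function.update_of_ne e', hν]
      have hinj : ν.Injective := fun z z' h => by rw [← hν z, h, hν]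
      have hfresh : ν' x ∉ (φ.name ν).freeVars := fun h => by
        obtain ⟨z, -, h⟩ := Fml.mem_freeVars_name h
        exact hne z h
      have hbound : ν' x ∉ (φ.name ν).boundVars := fun h => by
        rw [Fml.boundVars_name] at h
        obtain ⟨z, -, h⟩ := List.mem_map.1 h
        exact hne z h.symm
      refine .head (PolarRename.delta hfresh hbound) ?_
      rw [Fml.name_subst hinj _ hnd.1]
      refine (ih hnd.2 hν₁ (hγ.2.imp (fun z hz h => ?_) fun _ _ h => h) fun z hz => ?_).lift _
        fun _ _ => .quant _ _
      · rwa [Function.update_of_ne fun h : z = x => hnd.1 (h ▸ hz)]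
      · by_cases e' : z = x
        · rw [e', Function.update_self]
        · rw [Function.update_of_ne e']
          exact hf z ⟨hz, e'⟩

/-- One γ-simplification in a formula at a position of polarity `p`. -/
inductive PolarSimplification {L : FirstOrder.Language.{u, v}} {V : Type w} (p : Bool) :
    Fml L V → Fml L V → Prop
  | mk (C : Ctx L V) (y : V) (D H' : Fml L V)
      (hvar : Variant (.quant (gammaQ (p == C.pos)) y D) H') :
      PolarSimplification p
        (C.fill (.conn (alphaConn (p == C.pos)) (.quant (gammaQ (p == C.pos)) y D) H'))
        (C.fill (.quant (gammaQ (p == C.pos)) y D))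

/-! ### γ-simplification relative to a polarity. -/

section PolarSimplification

variable {φ ψ : Fml L V} {p : Bool}

theorem PolarSimplification.gammaSimplification (h : PolarSimplification true φ ψ) :
    GammaSimplification φ ψ := by
  obtain ⟨C, y, D, H', h⟩ := h
  simp only [Bool.true_beq] at h ⊢
  exact .mk C y D H' h

theorem PolarSimplification.neg (h : PolarSimplification (!p) φ ψ) :
    PolarSimplification p (.neg φ) (.neg ψ) := by
  obtain ⟨C, y, D, H', h⟩ := h
  rw [← beq_pos_neg] at h ⊢
  exact .mk C.neg y D H' h

theorem PolarSimplification.connL (c : Conn) (χ : Fml L V) (h : PolarSimplification p φ ψ) :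
    PolarSimplification p (.conn c φ χ) (.conn c ψ χ) := by
  obtain ⟨C, y, D, H', h⟩ := h
  exact .mk (.connL c C χ) y D H' h

theorem PolarSimplification.connR (c : Conn) (χ : Fml L V) (h : PolarSimplification p φ ψ) :
    PolarSimplification p (.conn c χ φ) (.conn c χ ψ) := by
  obtain ⟨C, y, D, H', h⟩ := h
  exact .mk (.connR c χ C) y D H' h

theorem PolarSimplification.quant (q : Quant) (x : V) (h : PolarSimplification p φ ψ) :
    PolarSimplification p (.quant q x φ) (.quant q x ψ) := by
  obtain ⟨C, y, D, H', h⟩ := h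
  exact .mk (.quant q x C) y D H' h

theorem PolarSimplification.gamma {y : V} {D H' : Fml L V}
    (hvar : Variant (.quant (gammaQ p) y D) H') :
    PolarSimplification p (.conn (alphaConn p) (.quant (gammaQ p) y D) H')
      (.quant (gammaQ p) y D) := by
  have e : (p == (Ctx.hole : Ctx L V).pos) = p := by cases p <;> rfl
  have h := PolarSimplification.mk (p := p) .hole y D H' (by rwa [e])
  rwa [e] at h

end PolarSimplification

/-- The δ-variables of a named formula are the names of δ-variables. -/
theorem skolem_of_name_eq_fill {φ : Fml L V} {p : Bool} {ν : V → DVar L V} {P : V → Prop}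
    (h : φ.ForQuants P (fun y => ∃ k z ts, ν y = .skolem k z ts) p)
    {C : Ctx (bulletLang L) (DVar L V)} {y : DVar L V} {H : Fml (bulletLang L) (DVar L V)}
    (e : φ.name ν = C.fill (.quant (deltaQ (p == C.pos)) y H)) :
    ∃ k z ts, y = .skolem k z ts := by
  induction C generalizing φ p with
  | hole =>
    have e' : (p == (Ctx.hole : Ctx (bulletLang L) (DVar L V)).pos) = p := by cases p <;> rfl
    rw [e'] at e
    cases φ with
    | quant q x φ =>
      obtain ⟨rfl, rfl, -⟩ := Fml.quant.inj e
      exact (Fml.forQuants_delta.1 h).1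
    | _ => simp [Fml.name, Ctx.fill] at e
  | neg C ih =>
    rw [beq_pos_neg] at e
    cases φ with
    | neg φ => exact ih (φ := φ) (p := !p) h (Fml.neg.inj e)
    | _ => simp [Fml.name, Ctx.fill] at e
  | connL c C χ ih =>
    cases φ with
    | conn c' φ ψ => exact ih h.1 (Fml.conn.inj e).2.1
    | _ => simp [Fml.name, Ctx.fill] at e
  | connR c χ C ih =>
    cases φ with
    | conn c' φ ψ => exact ih h.2 (Fml.conn.inj e).2.2
    | _ => simp [Fml.name, Ctx.fill] at e
  | quant q x C ih =>
    cases φ with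
    | quant q' x' φ =>
      refine ih (p := p) ?_ (Fml.quant.inj e).2.2
      rcases quant_eq_gammaQ_or_deltaQ p q' with rfl | rfl
      · exact (Fml.forQuants_gamma.1 h).2
      · exact (Fml.forQuants_delta.1 h).2
    | _ => simp [Fml.name, Ctx.fill] at e

end Naming

end Herbrand

namespace Herbrand

section Skolemization

variable {L : FirstOrder.Language.{u, v}} {V : Type w}

/-! ## Reading Skolem terms as variables -/

/-- The action of a substitution after reading Skolem terms as variables, if the Skolem terms are
not affected. -/
def readVar (σ : V → (skolemLang L V).Term V) : DVar L V → (bulletLang L).Term (DVar L V)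
  | .orig x => readTerm (σ x)
  | .skolem k y ts => .var (.skolem k y ts)

theorem readVar_var : readVar (L := L) (V := V) .var = .var := by
  funext w
  cases w <;> rfl

/-- Reading does not commute with substitution inside Skolem terms, because these become atomic. The
remedy is to let `ν` name δ-variables by Skolem terms that are already instantiated by `σ`; this is
the hypothesis `h`. -/
theorem nameTerm_subst_readVar {σ θ : V → (skolemLang L V).Term V} {ν : V → DVar L V}
    (h : ∀ z, readVar σ (ν z) = readTerm ((θ z).subst σ)) (t : L.Term V) :
    (nameTerm ν t).subst (readVar σ) = readTerm (((liftTerm t).subst θ).subst σ) := by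
  induction t with
  | var x => exact h x
  | func f ts ih =>
    simp only [nameTerm, liftTerm, FirstOrder.Language.Term.subst, readTerm, ih]

/-- The height of the Skolem term that a variable stands for, and 0 for an ordinary variable. -/
def DVar.rank : DVar L V → ℕ
  | .orig _ => 0
  | .skolem _ _ ts => 1 + Finset.univ.sup fun i => height (ts i)

theorem rank_le_height {t : (skolemLang L V).Term V} {v : DVar L V}
    (h : v ∈ termVars (readTerm t)) : v.rank ≤ height t := by
  induction t with
  | var x =>
    obtain rfl : v = .orig x := h
    exact Nat.zero_le _
  | @func k f ts ih =>
    cases f with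
    | old f =>
      obtain ⟨i, hi⟩ := Set.mem_iUnion.1 h
      have hle := Finset.le_sup (f := fun i => height (ts i)) (Finset.mem_univ i)
      have := ih i hi
      simp only [height]
      omega
    | skolem y =>
      obtain rfl : v = .skolem k y ts := h
      exact le_rfl

/-- Together with `rank_le_height`: variables read off an argument of a Skolem term have smaller
rank than that term. This is the rank condition in `WellFormed`. -/
theorem height_lt_rank {k : ℕ} {y : V} {ts : Fin k → (skolemLang L V).Term V}
    {t : (skolemLang L V).Term V} (h : t ∈ List.ofFn ts) :
    height t < (DVar.skolem (L := L) k y ts).rank := by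
  obtain ⟨i, rfl⟩ := (List.mem_ofFn' _ _).1 h
  have hle := Finset.le_sup (f := fun i => height (ts i)) (Finset.mem_univ i)
  simp only [DVar.rank]
  omega

theorem mem_termVars_of_orig_mem {t : (skolemLang L V).Term V} {z : V}
    (h : DVar.orig z ∈ termVars (readTerm t)) : z ∈ termVars t := by
  induction t with
  | var x => exact DVar.orig.inj h
  | @func k f ts ih =>
    cases f with
    | old f =>
      obtain ⟨i, hi⟩ := Set.mem_iUnion.1 h
      exact Set.mem_iUnion.2 ⟨i, ih i hi⟩
    | skolem y => cases h

theorem readTerm_subst_readVar {σ : V → (skolemLang L V).Term V} {t : (skolemLang L V).Term V}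
    (h : ∀ z ∈ termVars t, σ z = .var z) : (readTerm t).subst (readVar σ) = readTerm t := by
  refine subst_eq_self _ fun v hv => ?_
  cases v with
  | orig z =>
    simp only [readVar, h z (mem_termVars_of_orig_mem hv)]
    rfl
  | skolem k y ts => rfl

theorem Fml.QuantFree.read {φ : Fml (skolemLang L V) V} (h : φ.QuantFree) :
    φ.read.QuantFree := by
  induction φ with
  | rel R ts => trivial
  | neg φ ih => exact ih h
  | conn c φ ψ ih ih' => exact ⟨ih h.1, ih' h.2⟩
  | quant q x φ ih => exact h

/-- Valuations are pulled back along `readTerm`, so reading preserves tautologies. -/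
theorem Fml.holds_read
    (val : ∀ k, L.Relations k → (Fin k → (bulletLang L).Term (DVar L V)) → Prop)
    (φ : Fml (skolemLang L V) V) :
    φ.read.Holds val ↔
      φ.Holds (L := skolemLang L V) fun k R ts => val k R fun i => readTerm (ts i) := by
  induction φ with
  | rel R ts => rfl
  | neg φ ih => exact not_congr ih
  | conn c φ ψ ih ih' =>
    cases c
    · exact or_congr ih ih'
    · exact and_congr ih ih'
  | quant q x φ ih => rfl

theorem Fml.Tautology.read {φ : Fml (skolemLang L V) V} (h : φ.Tautology) : φ.read.Tautology :=
  ⟨h.1.read, fun val => (Fml.holds_read val φ).2 (h.2 _)⟩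

/-! ## Skolemization with an environment -/

open Classical in
/-- Outer Skolemization, where the free variables are at the same time replaced according
to `θ`. -/
noncomputable def skolemWith :
    Bool → List V → (V → (skolemLang L V).Term V) → Fml L V → Fml (skolemLang L V) V
  | _, _, θ, .rel (k := k) R ts =>
      Fml.rel (L := skolemLang L V) (k := k) R fun i => (liftTerm (ts i)).subst θ
  | p, xs, θ, .neg φ => .neg (skolemWith (!p) xs θ φ)
  | p, xs, θ, .conn c φ ψ => .conn c (skolemWith p xs θ φ) (skolemWith p xs θ ψ)
  | true, xs, θ, .quant .ex x φ => .quant .ex x (skolemWith true (xs ++ [x]) θ φ)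
  | false, xs, θ, .quant .all x φ => .quant .all x (skolemWith false (xs ++ [x]) θ φ)
  | true, xs, θ, .quant .all y φ =>
      skolemWith true xs (Function.update θ y (skolemTerm y xs)) φ
  | false, xs, θ, .quant .ex y φ =>
      skolemWith false xs (Function.update θ y (skolemTerm y xs)) φ

theorem skolemWith_gamma (p : Bool) (xs : List V) (θ : V → (skolemLang L V).Term V) (x : V)
    (φ : Fml L V) : skolemWith p xs θ (.quant (gammaQ p) x φ) =
      .quant (gammaQ p) x (skolemWith p (xs ++ [x]) θ φ) := by
  cases p <;> rfl

open Classical in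
theorem skolemWith_delta (p : Bool) (xs : List V) (θ : V → (skolemLang L V).Term V) (y : V)
    (φ : Fml L V) : skolemWith p xs θ (.quant (deltaQ p) y φ) =
      skolemWith p xs (Function.update θ y (skolemTerm y xs)) φ := by
  cases p <;> rfl

theorem mem_termVars_skolemTerm {y v : V} {xs : List V} :
    v ∈ termVars (skolemTerm (L := L) y xs) ↔ v ∈ xs := by
  simp only [skolemTerm, termVars, Set.mem_iUnion, Set.mem_singleton_iff]
  exact ⟨fun ⟨i, h⟩ => h ▸ xs.get_mem i, fun h => (List.mem_iff_get.1 h).imp fun _ => Eq.symm⟩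

-- A substitution made after Skolemizing the scope can be moved into the environment, provided no
-- other entry mentions `y`.
open Classical in
theorem skolemWith_subst {p : Bool} {xs : List V} {θ : V → (skolemLang L V).Term V} {y : V}
    {s : (skolemLang L V).Term V} {φ : Fml L V} (hy : y ∉ φ.boundVars) (hxs : y ∉ xs)
    (hθy : θ y = .var y) (hθ : ∀ z, z ≠ y → y ∉ termVars (θ z)) :
    (skolemWith p xs θ φ).subst y s = skolemWith p xs (Function.update θ y s) φ := by
  induction φ generalizing p xs θ with
  | rel R ts =>
    simp only [skolemWith, Fml.subst, subst_subst]
    congr 1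
    funext i
    congr 1
    funext z
    by_cases e : z = y
    · rw [e, hθy, Function.update_self]
      exact single_self _ _
    · rw [Function.update_of_ne e]
      exact subst_eq_self _ fun v hv => single_of_ne _ fun e' => hθ z e (e' ▸ hv)
  | neg φ ih => exact congrArg _ (ih hy hxs hθy hθ)
  | conn c φ ψ ih ih' =>
    simp only [Fml.boundVars, List.mem_append, not_or] at hy
    simp only [skolemWith, Fml.subst, ih hy.1 hxs hθy hθ, ih' hy.2 hxs hθy hθ]
  | quant q x φ ih =>
    simp only [Fml.boundVars, List.mem_cons, not_or] at hy
    rcases quant_eq_gammaQ_or_deltaQ p q with rfl | rfl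
    · rw [skolemWith_gamma, skolemWith_gamma, Fml.subst, if_neg (Ne.symm hy.1),
        ih hy.2 (by simp [hxs, hy.1]) hθy hθ]
    · rw [skolemWith_delta, skolemWith_delta, Function.update_comm hy.1, ih hy.2 hxs]
      · rw [Function.update_of_ne hy.1, hθy]
      · intro z hz
        by_cases e : z = x
        · rwa [e, Function.update_self, mem_termVars_skolemTerm]
        · rw [Function.update_of_ne e]
          exact hθ z hz

/-- Replaces the substitutions of `skolemize`, made after the recursive calls, by an environment
passed downwards, which permits induction on the unskolemized formula. -/
theorem skolemize_lift {p : Bool} {xs : List V} {φ : Fml L V} (hnd : φ.boundVars.Nodup)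
    (hxs : ∀ x ∈ φ.boundVars, x ∉ xs) : skolemize p xs φ.lift = skolemWith p xs .var φ := by
  induction φ generalizing p xs with
  | rel R ts =>
    refine congrArg _ (funext fun i => (subst_eq_self _ fun _ _ => rfl).symm)
  | neg φ ih => exact congrArg _ (ih hnd hxs)
  | conn c φ ψ ih ih' =>
    rw [Fml.boundVars, List.nodup_append'] at hnd
    simp only [Fml.lift, skolemize, skolemWith,
      ih hnd.1 fun x hx => hxs x (List.mem_append_left _ hx),
      ih' hnd.2.1 fun x hx => hxs x (List.mem_append_right _ hx)]
  | quant q x φ ih =>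
    rw [Fml.boundVars, List.nodup_cons] at hnd
    rcases quant_eq_gammaQ_or_deltaQ p q with rfl | rfl
    · have h : skolemize p xs (Fml.quant (gammaQ p) x φ).lift =
          .quant (gammaQ p) x (skolemize p (xs ++ [x]) φ.lift) := by cases p <;> rfl
      rw [h, skolemWith_gamma, ih hnd.2]
      intro z hz
      have hzx : z ≠ x := fun e => hnd.1 (e ▸ hz)
      simp [hxs z (List.mem_cons_of_mem _ hz), hzx]
    · have h : skolemize p xs (Fml.quant (deltaQ p) x φ).lift =
          (skolemize p xs φ.lift).subst x (skolemTerm x xs) := by cases p <;> rfl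
      rw [h, skolemWith_delta, ih hnd.2 fun z hz => hxs z (List.mem_cons_of_mem _ hz)]
      exact skolemWith_subst hnd.1 (hxs x List.mem_cons_self) rfl fun z hz h => hz h.symm

theorem termVars_liftTerm (t : L.Term V) : termVars (liftTerm t) = termVars t := by
  induction t with
  | var x => rfl
  | func f ts ih => simp only [liftTerm, termVars, ih]

theorem mem_freeVars_skolemWith {p : Bool} {xs : List V} {θ : V → (skolemLang L V).Term V}
    {φ : Fml L V} (hnd : φ.boundVars.Nodup) (hθ : ∀ x ∈ φ.boundVars, θ x = .var x) {v : V}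
    (hv : v ∈ (skolemWith p xs θ φ).freeVars) :
    v ∈ xs ∨ ∃ z ∈ φ.freeVars, v ∈ termVars (θ z) := by
  classical
  induction φ generalizing p xs θ with
  | rel R ts =>
    obtain ⟨i, hi⟩ := Set.mem_iUnion.1 hv
    obtain ⟨z, hz, hv⟩ := mem_termVars_subst.1 hi
    exact .inr ⟨z, Set.mem_iUnion.2 ⟨i, termVars_liftTerm (ts i) ▸ hz⟩, hv⟩
  | neg φ ih => exact ih hnd hθ hv
  | conn c φ ψ ih ih' =>
    rw [Fml.boundVars, List.nodup_append'] at hnd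
    rcases hv with hv | hv
    · exact (ih hnd.1 (fun x hx => hθ x (List.mem_append_left _ hx)) hv).imp_right
        fun ⟨z, hz, h⟩ => ⟨z, .inl hz, h⟩
    · exact (ih' hnd.2.1 (fun x hx => hθ x (List.mem_append_right _ hx)) hv).imp_right
        fun ⟨z, hz, h⟩ => ⟨z, .inr hz, h⟩
  | quant q x φ ih =>
    rw [Fml.boundVars, List.nodup_cons] at hnd
    rcases quant_eq_gammaQ_or_deltaQ p q with rfl | rfl
    · rw [skolemWith_gamma] at hv
      obtain ⟨hv, hvx⟩ := hv
      rcases ih hnd.2 (fun z hz => hθ z (List.mem_cons_of_mem _ hz)) hv with h | ⟨z, hz, h⟩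
      · rcases List.mem_append.1 h with h | h
        · exact .inl h
        · exact (hvx (List.mem_singleton.1 h)).elim
      · refine .inr ⟨z, ⟨hz, fun e => hvx ?_⟩, h⟩
        obtain rfl : z = x := e
        rwa [hθ z List.mem_cons_self] at h
    · rw [skolemWith_delta] at hv
      have hθ' : ∀ z ∈ φ.boundVars, Function.update θ x (skolemTerm x xs) z = .var z := by
        intro z hz
        rw [Function.update_of_ne fun e : z = x => hnd.1 (e ▸ hz)]
        exact hθ z (List.mem_cons_of_mem _ hz)
      rcases ih hnd.2 hθ' hv with h | ⟨z, hz, h⟩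
      · exact .inl h
      · by_cases e : z = x
        · rw [e, Function.update_self, mem_termVars_skolemTerm] at h
          exact .inl h
        · rw [Function.update_of_ne e] at h
          exact .inr ⟨z, ⟨hz, e⟩, h⟩

/-! ## From expansions to annotated formulas -/

/-- The annotated formula `a` links the expansion `B`, instantiated according to `σ`, with the
formula `R`, which is obtained by γ-simplification after dropping the annotations. Its
γ-variables belong to `X` and its free variables to `S`. -/
structure IsAnnotation (Γ X S : Set (DVar L V)) (p : Bool) (σ : V → (skolemLang L V).Term V)
    (B : Fml (skolemLang L V) V) (R : Fml (bulletLang L) (DVar L V))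
    (a : Annotated (bulletLang L) (DVar L V)) : Prop where
  flat_bind : a.flat.bind (readVar σ) = (B.bind σ).read
  simplification : Relation.ReflTransGen (PolarSimplification p) (a.forget p) R
  wellFormed : a.WellFormed Γ DVar.rank
  gammas_subset : a.gammas ⊆ X
  nodup : a.deltas.Nodup
  freeVars_subset : (a.forget p).freeVars ⊆ S

theorem IsAnnotation.conn {Γ X Y S T : Set (DVar L V)} {p : Bool}
    {σ : V → (skolemLang L V).Term V} {B C : Fml (skolemLang L V) V}
    {R Q : Fml (bulletLang L) (DVar L V)} {a b : Annotated (bulletLang L) (DVar L V)} (c : Conn)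
    (ha : IsAnnotation Γ X S p σ B R a) (hb : IsAnnotation Γ Y T p σ C Q b)
    (hab : a.deltas.Disjoint b.deltas) :
    IsAnnotation Γ (X ∪ Y) (S ∪ T) p σ (.conn c B C) (.conn c R Q) (.conn c a b) where
  flat_bind := congrArg₂ (Fml.conn c) ha.flat_bind hb.flat_bind
  simplification :=
    (ha.simplification.lift (Fml.conn c · _) fun _ _ => .connL c _).trans
      (hb.simplification.lift (Fml.conn c _) fun _ _ => .connR c _)
  wellFormed := ⟨ha.wellFormed, hb.wellFormed⟩
  gammas_subset := Set.union_subset_union ha.gammas_subset hb.gammas_subset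
  nodup := List.nodup_append'.2 ⟨ha.nodup, hb.nodup, hab⟩
  freeVars_subset := Set.union_subset_union ha.freeVars_subset hb.freeVars_subset

/-- Induction on the bracketing: each half of a join simplifies to one of its copies, and as the
copies are variants of each other, one more γ-simplification keeps the left one. Which copy `t`
survives depends on the bracketing. -/
theorem IsJoin.exists_annotation {ι : Type*} {Γ X S : Set (DVar L V)} {p : Bool}
    {σ : V → (skolemLang L V).Term V} {y : DVar L V} {B : ι → Fml (skolemLang L V) V}
    {R : ι → Fml (bulletLang L) (DVar L V)} {a : ι → Annotated (bulletLang L) (DVar L V)}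
    {l : List ι} {D : Fml (skolemLang L V) V}
    (hD : IsJoin (alphaConn p) (l.map B) D) (hnd : l.Nodup)
    (ha : ∀ t ∈ l, IsAnnotation Γ X S p σ (B t) (.quant (gammaQ p) y (R t)) (a t))
    (hR : ∀ t ∈ l, ∀ s ∈ l,
      Variant (.quant (gammaQ p) y (R t)) (.quant (gammaQ p) y (R s)))
    (hdisj : ∀ t ∈ l, ∀ s ∈ l, t ≠ s → (a t).deltas.Disjoint (a s).deltas) :
    ∃ b, ∃ t ∈ l, IsAnnotation Γ X S p σ D (.quant (gammaQ p) y (R t)) b ∧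
      ∀ s ∈ b.deltas, ∃ r ∈ l, s ∈ (a r).deltas := by
  generalize hl : l.map B = l' at hD
  induction hD generalizing l with
  | single φ =>
    obtain ⟨t, rfl, rfl⟩ := List.map_eq_singleton_iff.1 hl
    have ht : t ∈ [t] := List.mem_singleton_self t
    exact ⟨a t, t, ht, ha t ht, fun s hs => ⟨t, ht, hs⟩⟩
  | join _ _ ih ih' =>
    obtain ⟨l₁, l₂, rfl, h₁, h₂⟩ := List.map_eq_append_iff.1 hl
    have hL : ∀ t ∈ l₁, t ∈ l₁ ++ l₂ := fun t => List.mem_append_left _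
    have hRt : ∀ t ∈ l₂, t ∈ l₁ ++ l₂ := fun t => List.mem_append_right _
    rw [List.nodup_append'] at hnd
    obtain ⟨b₁, t₁, ht₁, hb₁, hd₁⟩ := ih hnd.1 (fun t ht => ha t (hL t ht))
      (fun t ht s hs => hR t (hL t ht) s (hL s hs))
      (fun t ht s hs => hdisj t (hL t ht) s (hL s hs)) h₁
    obtain ⟨b₂, t₂, ht₂, hb₂, hd₂⟩ := ih' hnd.2.1 (fun t ht => ha t (hRt t ht))
      (fun t ht s hs => hR t (hRt t ht) s (hRt s hs))
      (fun t ht s hs => hdisj t (hRt t ht) s (hRt s hs)) h₂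
    have hdis : b₁.deltas.Disjoint b₂.deltas := by
      intro s hs₁ hs₂
      obtain ⟨r₁, hr₁, h₁⟩ := hd₁ s hs₁
      obtain ⟨r₂, hr₂, h₂⟩ := hd₂ s hs₂
      exact hdisj r₁ (hL _ hr₁) r₂ (hRt _ hr₂) (fun e => hnd.2.2 hr₁ (e ▸ hr₂)) h₁ h₂
    have h := hb₁.conn (alphaConn p) hb₂ hdis
    rw [Set.union_self, Set.union_self] at h
    refine ⟨_, t₁, hL _ ht₁, { h with
      simplification := h.simplification.tail (.gamma (hR t₁ (hL _ ht₁) t₂ (hRt _ ht₂))) }, ?_⟩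
    intro s hs
    rcases List.mem_append.1 hs with hs | hs
    · obtain ⟨r, hr, h⟩ := hd₁ s hs
      exact ⟨r, hL _ hr, h⟩
    · obtain ⟨r, hr, h⟩ := hd₂ s hs
      exact ⟨r, hRt _ hr, h⟩

theorem ofFn_get_map {α β : Type*} (f : α → β) (xs : List α) :
    (List.ofFn fun i => f (xs.get i)) = xs.map f := by
  apply List.ext_get <;> simp

/-- Each sub-expansion of a Skolemized formula is linked by an annotated formula with a copy of
the original formula whose δ-variables are named by Skolem terms. -/
theorem exists_annotation {G : Set V} {T : Set ((skolemLang L V).Term V)}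
    (hT : ∀ t ∈ T, ∀ z ∈ termVars t, z ∉ G) {A : Fml L V} (hnd : A.boundVars.Nodup)
    (hbf : ∀ x ∈ A.boundVars, x ∉ A.freeVars) (hG : ∀ x ∈ A.boundVars, x ∈ G) {p : Bool}
    {xs : List V} {θ σ : V → (skolemLang L V).Term V} {ν : V → DVar L V}
    {B : Fml (skolemLang L V) V} (hσ : ∀ z, z ∉ G → σ z = .var z)
    (hν : ∀ z, (ν z).base = z) (hνθ : ∀ z, readVar σ (ν z) = readTerm ((θ z).subst σ))
    (hb : ∀ x ∈ A.boundVars, x ∉ xs ∧ ν x = .orig x ∧ θ x = .var x ∧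
      ∀ z, z ≠ x → x ∉ termVars (θ z))
    (hB : SubExpansion T (skolemWith p xs θ A) B) :
    ∃ a ν', IsAnnotation (DVar.orig '' G) (DVar.orig '' {x | x ∈ A.boundVars})
        (ν '' A.freeVars) p σ B (A.name ν') a ∧
      (∀ s ∈ a.deltas, ∃ y ∈ A.boundVars, ∃ k ts, s = .skolem k y ts ∧
        xs.map σ <+: List.ofFn ts) ∧
      (∀ z, (ν' z).base = z) ∧ (∀ z, z ∉ A.boundVars → ν' z = ν z) ∧
      A.ForQuants (fun x => ν' x = .orig x) (fun y => ∃ k z ts, ν' y = .skolem k z ts) p := by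
  classical
  induction A generalizing p xs θ σ ν B with
  | rel R ts =>
    cases hB
    refine ⟨.rel (L := bulletLang L) R fun i => nameTerm ν (ts i), ν,
      ⟨?_, .refl, trivial, Set.empty_subset _, List.nodup_nil, ?_⟩, by simp [Annotated.deltas],
      hν, fun _ _ => rfl, trivial⟩
    · simp only [Annotated.flat, Fml.bind, Fml.read, nameTerm_subst_readVar hνθ]
    · intro v hv
      obtain ⟨z, hz, rfl⟩ := Fml.mem_freeVars_name (φ := .rel R ts) hv
      exact ⟨z, hz, rfl⟩
  | neg A ih =>
    cases hB with | neg hB => ?_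
    obtain ⟨a, ν', ha, hd, h⟩ := ih hnd hbf hG hσ hν hνθ hb hB
    exact ⟨.neg a, ν', ⟨congrArg Fml.neg ha.flat_bind,
      ha.simplification.lift _ fun _ _ => .neg, ha.wellFormed, ha.gammas_subset, ha.nodup,
      ha.freeVars_subset⟩, hd, h⟩
  | conn c A A' ih ih' =>
    cases hB with | conn _ hB hB' => ?_
    rw [Fml.boundVars, List.nodup_append'] at hnd
    have hl : ∀ x ∈ A.boundVars, x ∈ (Fml.conn c A A').boundVars :=
      fun x => List.mem_append_left _
    have hr : ∀ x ∈ A'.boundVars, x ∈ (Fml.conn c A A').boundVars :=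
      fun x => List.mem_append_right _
    obtain ⟨a, ν₁, ha, hd, hb₁, ho₁, hq₁⟩ := ih hnd.1 (fun x hx h => hbf x (hl x hx) (.inl h))
      (fun x hx => hG x (hl x hx)) hσ hν hνθ (fun x hx => hb x (hl x hx)) hB
    obtain ⟨a', ν₂, ha', hd', hb₂, ho₂, hq₂⟩ := ih' hnd.2.1
      (fun x hx h => hbf x (hr x hx) (.inr h))
      (fun x hx => hG x (hr x hx)) hσ hν hνθ (fun x hx => hb x (hr x hx)) hB'
    -- The namings of the two sides are glued; they agree off the bound variables of both sides, and
    -- in particular on the free variables shared.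
    let ν' : V → DVar L V := fun z => if z ∈ A.boundVars then ν₁ z else ν₂ z
    have hν₁ : ∀ z ∈ A.boundVars, ν₁ z = ν' z := fun z hz => (if_pos hz).symm
    have hν₂ : ∀ z, z ∉ A.boundVars → ν₂ z = ν' z := fun z hz => (if_neg hz).symm
    have hA'b : ∀ z ∈ A'.boundVars, z ∉ A.boundVars := fun z hz hz' => hnd.2.2 hz' hz
    have hn₁ : A.name ν₁ = A.name ν' := by
      refine A.name_congr (fun z hz => ?_) hν₁
      by_cases hzb : z ∈ A.boundVars
      · exact hν₁ z hzb
      · rw [← hν₂ z hzb, ho₁ z hzb, ho₂ z fun h => hbf z (hr z h) (.inl hz)]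
    have hn₂ : A'.name ν₂ = A'.name ν' :=
      A'.name_congr (fun z hz => hν₂ z fun h => hbf z (hl z h) (.inr hz))
        fun z hz => hν₂ z (hA'b z hz)
    -- Different sides bind different variables, hence have different Skolem symbols.
    have hdis : a.deltas.Disjoint a'.deltas := by
      intro s hs hs'
      obtain ⟨y, hy, k, ts, rfl, -⟩ := hd s hs
      obtain ⟨y', hy', k', ts', e, -⟩ := hd' _ hs'
      obtain ⟨-, rfl, -⟩ := DVar.skolem.inj e
      exact hnd.2.2 hy hy'
    have h := ha.conn c ha' hdis
    refine ⟨.conn c a a', ν', ⟨h.flat_bind, ?_, h.wellFormed, h.gammas_subset.trans ?_, h.nodup,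
      h.freeVars_subset.trans ?_⟩, ?_, ?_, ?_, ?_, ?_⟩
    · rw [Fml.name, ← hn₁, ← hn₂]
      exact h.simplification
    · rw [← Set.image_union]
      exact Set.image_mono (Set.union_subset hl hr)
    · rw [← Set.image_union]
      exact subset_rfl
    · intro s hs
      rcases List.mem_append.1 hs with hs | hs
      · obtain ⟨y, hy, h⟩ := hd s hs
        exact ⟨y, hl y hy, h⟩
      · obtain ⟨y, hy, h⟩ := hd' s hs
        exact ⟨y, hr y hy, h⟩
    · intro z
      by_cases hz : z ∈ A.boundVars
      · rw [← hν₁ z hz, hb₁]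
      · rw [← hν₂ z hz, hb₂]
    · intro z hz
      simp only [Fml.boundVars, List.mem_append, not_or] at hz
      rw [← hν₂ z hz.1, ho₂ z hz.2]
    · exact hq₁.imp (fun z hz h => hν₁ z hz ▸ h) fun z hz h => hν₁ z hz ▸ h
    · exact hq₂.imp (fun z hz h => hν₂ z (hA'b z hz) ▸ h) fun z hz h => hν₂ z (hA'b z hz) ▸ h
  | quant q x A ih =>
    rw [Fml.boundVars, List.nodup_cons] at hnd
    have hmem : ∀ z ∈ A.boundVars, z ∈ (Fml.quant q x A).boundVars :=
      fun z => List.mem_cons_of_mem _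
    have hne : ∀ z ∈ A.boundVars, z ≠ x := fun z hz e => hnd.1 (e ▸ hz)
    have hbf' : ∀ z ∈ A.boundVars, z ∉ A.freeVars := fun z hz h =>
      hbf z (hmem z hz) ⟨h, hne z hz⟩
    have hG' : ∀ z ∈ A.boundVars, z ∈ G := fun z hz => hG z (hmem z hz)
    have hxG : x ∈ G := hG x List.mem_cons_self
    obtain ⟨hxxs, hνx, hθx, hθz⟩ := hb x List.mem_cons_self
    rcases quant_eq_gammaQ_or_deltaQ p q with rfl | rfl
    · rw [skolemWith_gamma] at hB
      cases hB with | quant _ _ _ l E _ hl0 hlnd hok hE hD => ?_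
      have hσt : ∀ t ∈ l, ∀ z ∈ termVars t, σ z = .var z := fun t ht z hz =>
        hσ z (hT t (hok ht) z hz)
      -- The copy for `t` is treated with `σ` extended by `x ↦ t`, so that the Skolem terms below
      -- are instantiated with `t`.
      have key : ∀ t ∈ l, _ := fun t ht =>
        ih (xs := xs ++ [x]) (σ := Function.update σ x t) (θ := θ) (ν := ν) hnd.2 hbf' hG'
          (fun z hz => by
            rw [Function.update_of_ne fun e : z = x => hz (e ▸ hxG)]
            exact hσ z hz) hν
          (fun z => by
            by_cases e : z = x
            · subst e
              rw [hνx, hθx]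
              rfl
            · rw [subst_congr (τ := σ) (θ z) fun w hw =>
                Function.update_of_ne (fun e' : w = x => hθz z e (e' ▸ hw)) _ _, ← hνθ z]
              -- If the name of `z` is an ordinary variable, it is `z` itself and not affected by
              -- the update at `x`; a Skolem name is atomic.
              have hz := hν z
              cases hw : ν z with
              | orig w =>
                rw [hw] at hz
                obtain rfl : w = z := hz
                simp only [readVar, Function.update_of_ne e]
              | skolem k y ts => rfl)
          (fun z hz => by
            obtain ⟨h₁, h₂⟩ := hb z (hmem z hz)
            exact ⟨by simp [h₁, hne z hz], h₂⟩)
          (hE t ht)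
      obtain ⟨t₀, ht₀⟩ := List.exists_mem_of_ne_nil l hl0
      have : Nonempty (Annotated (bulletLang L) (DVar L V)) := ⟨(key t₀ ht₀).choose⟩
      have : Nonempty (V → DVar L V) := ⟨ν⟩
      choose! a ν' ha hd hb' ho hq using key
      have hmap : ∀ t, (xs ++ [x]).map (Function.update σ x t) = xs.map σ ++ [t] := fun t => by
        rw [List.map_append, List.map_congr_left (g := σ) fun z hz =>
          Function.update_of_ne (fun e : z = x => hxxs (e ▸ hz)) _ _]
        simp
      simp only [hmap] at hd
      have hν'x : ∀ t ∈ l, ν' t x = .orig x := fun t ht => by rw [ho t ht x hnd.1, hνx]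
      obtain ⟨b, t, ht, hb'', hbd⟩ := IsJoin.exists_annotation (Γ := DVar.orig '' G)
        (X := DVar.orig '' {z | z ∈ (Fml.quant (gammaQ p) x A).boundVars})
        (S := ν '' (Fml.quant (gammaQ p) x A).freeVars) (σ := σ) (y := .orig x)
        (R := fun t => A.name (ν' t)) (a := fun t => .gamma (.orig x) (readTerm t) (a t))
        (gammaQ_conn p ▸ hD) hlnd
        (fun t ht => by
          refine ⟨?_, (ha t ht).simplification.lift _ fun _ _ => .quant _ _, ?_, ?_,
            (ha t ht).nodup, ?_⟩
          · rw [Annotated.flat, (a t).flat_quantFree.subst_bind,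
              (hE t ht).quantFree.subst_bind]
            have e₁ : (fun z => (single x t z).subst σ) = Function.update σ x t := by
              funext z
              by_cases e : z = x
              · rw [e, single_self, Function.update_self]
                exact subst_eq_self _ (hσt t ht)
              · rw [single_of_ne _ e, Function.update_of_ne e]
                rfl
            -- As `t` contains no bound variable of `A`, `σ` leaves it fixed; instantiating `x`
            -- first and `σ` afterwards is a single instantiation.
            have e₂ : (fun z => (single (DVar.orig x) (readTerm t) z).subst (readVar σ)) =
                readVar (Function.update σ x t) := by
              funext z
              by_cases e : z = .orig x
              · rw [e, single_self, readTerm_subst_readVar (hσt t ht)]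
                simp [readVar]
              · rw [single_of_ne _ e]
                cases z with
                | orig z =>
                  have hzx : z ≠ x := fun h => e (h ▸ rfl)
                  simp only [readVar, Function.update_of_ne hzx]
                  rfl
                | skolem k y ts => rfl
            rw [e₁, e₂]
            exact (ha t ht).flat_bind
          · refine ⟨⟨x, hxG, rfl⟩, ?_, fun h => ?_, fun v hv s hs => ?_, (ha t ht).wellFormed⟩
            · rintro _ hv ⟨z, hz, rfl⟩
              exact hT t (hok ht) z (mem_termVars_of_orig_mem hv) hz
            · obtain ⟨z, hz, e⟩ := (ha t ht).gammas_subset h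
              exact hne z hz (DVar.orig.inj e)
            -- By the prefix condition `t` is an argument of the Skolem term `s`.
            · obtain ⟨y, -, k, ts, rfl, hpre⟩ := hd t ht s hs
              exact (rank_le_height hv).trans_lt (height_lt_rank (hpre.subset (by simp)))
          · rintro _ (rfl | h)
            · exact ⟨x, List.mem_cons_self, rfl⟩
            · exact Set.image_mono (fun z hz => hmem z hz) ((ha t ht).gammas_subset h)
          · rintro v ⟨hv, hvx⟩
            obtain ⟨z, hz, rfl⟩ := (ha t ht).freeVars_subset hv
            exact ⟨z, ⟨hz, fun e => hvx (by rw [e, hνx]; rfl)⟩, rfl⟩)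
        (fun t ht s hs => by
          refine (polarRename_name (p := p) hnd.2 (hb' t ht) (hb' s hs) ?_ fun z hz => ?_).lift
            _ fun _ _ h => (h.quant _ _).rename
          · exact ((hq t ht).and (hq s hs)).imp (fun _ _ h => h.1.trans h.2.symm)
              fun _ _ _ => trivial
          · have hz' : z ∉ A.boundVars := fun h => hbf' z h hz
            rw [ho t ht z hz', ho s hs z hz'])
        -- A δ-variable common to the copies for `t` and `s` would have both `xs.map σ ++ [t]` and
        -- `xs.map σ ++ [s]` as prefixes of its argument list, forcing `t = s`.
        (fun t ht s hs hts w hw hw' => by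
          obtain ⟨y, -, k, ts, rfl, hpre⟩ := hd t ht w hw
          obtain ⟨y', -, k', ts', e, hpre'⟩ := hd s hs _ hw'
          obtain ⟨rfl, -, h⟩ := DVar.skolem.inj e
          obtain rfl := eq_of_heq h
          have h := List.prefix_of_prefix_length_le hpre hpre' (by simp)
          have h' := h.eq_of_length (by simp)
          exact hts (by simpa using h'))
      refine ⟨b, ν' t, ?_, fun s hs => ?_, hb' t ht, fun z hz => ho t ht z fun h =>
        hz (hmem z h), Fml.forQuants_gamma.2 ⟨hν'x t ht, hq t ht⟩⟩
      · rw [Fml.name, hν'x t ht]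
        exact hb''
      · obtain ⟨r, hr, hs⟩ := hbd s hs
        obtain ⟨y, hy, k, ts, rfl, hpre⟩ := hd r hr s hs
        exact ⟨y, hmem y hy, k, ts, rfl, (List.prefix_append _ _).trans hpre⟩
    · rw [skolemWith_delta] at hB
      -- The δ-variable is named by its Skolem term with `σ` already applied to the arguments.
      obtain ⟨w, hw⟩ : ∃ w, w = DVar.skolem (L := L) xs.length x fun i => σ (xs.get i) := ⟨_, rfl⟩
      obtain ⟨a, ν', ha, hd, hb', ho, hq⟩ := ih (ν := Function.update ν x w) hnd.2 hbf' hG' hσ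
        (fun z => by
          by_cases e : z = x
          · rw [e, Function.update_self, hw]
            rfl
          · rw [Function.update_of_ne e, hν])
        (fun z => by
          by_cases e : z = x
          · rw [e, Function.update_self, Function.update_self, hw]
            rfl
          · rw [Function.update_of_ne e, Function.update_of_ne e, hνθ])
        (fun z hz => by
          obtain ⟨h₁, h₂, h₃, h₄⟩ := hb z (hmem z hz)
          refine ⟨h₁, ?_, ?_, fun z' hz' => ?_⟩
          · rw [Function.update_of_ne (hne z hz), h₂]
          · rw [Function.update_of_ne (hne z hz), h₃]
          · by_cases e : z' = x
            · rwa [e, Function.update_self, mem_termVars_skolemTerm]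
            · rw [Function.update_of_ne e]
              exact h₄ z' hz')
        hB
      have hν'x : ν' x = w := by rw [ho x hnd.1, Function.update_self]
      refine ⟨.delta w a, ν', ⟨ha.flat_bind, ?_, ⟨?_, ha.wellFormed⟩, ?_, ?_, ?_⟩, ?_, hb', ?_, ?_⟩
      · rw [Fml.name, hν'x]
        exact ha.simplification.lift _ fun _ _ => .quant _ _
      · rintro ⟨z, -, h⟩
        rw [hw] at h
        cases h
      · exact ha.gammas_subset.trans (Set.image_mono fun z hz => hmem z hz)
      · refine List.nodup_cons.2 ⟨fun h => ?_, ha.nodup⟩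
        obtain ⟨y, hy, k, ts, e, -⟩ := hd w h
        rw [hw] at e
        exact hne y hy (DVar.skolem.inj e).2.1.symm
      · rintro v ⟨hv, hvx⟩
        obtain ⟨z, hz, rfl⟩ := ha.freeVars_subset hv
        have e : z ≠ x := fun e => hvx (by rw [e, Function.update_self]; rfl)
        exact ⟨z, ⟨hz, e⟩, (Function.update_of_ne e _ _).symm⟩
      · intro s hs
        rcases List.mem_cons.1 hs with rfl | hs
        · exact ⟨x, List.mem_cons_self, _, _, hw, (ofFn_get_map σ xs).symm ▸ List.prefix_rfl⟩
        · obtain ⟨y, hy, h⟩ := hd s hs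
          exact ⟨y, hmem y hy, h⟩
      · intro z hz
        simp only [Fml.boundVars, List.mem_cons, not_or] at hz
        rw [ho z hz.2, Function.update_of_ne hz.1]
      · exact Fml.forQuants_delta.2 ⟨⟨_, _, _, hν'x.trans hw⟩, hq⟩

/-- Every sub-expansion that is a sentential tautology is the start of a linear derivation. -/
theorem hasLinearDerivation_of_subExpansion {A : Fml L V} (hA : A.Rectified) {n : ℕ}
    {B : Fml (skolemLang L V) V}
    (hB : SubExpansion (champFini n (outerSkolem A)) (outerSkolem A) B) (ht : B.Tautology) :
    HasLinearDerivation B A := by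
  obtain ⟨-, hbf, hnd⟩ := hA
  have hsk : outerSkolem A = skolemWith true [] .var A := skolemize_lift hnd (by simp)
  -- Variables of the champ fini are free in the Skolemized form, hence free in `A`, and `A` is
  -- rectified.
  have hT : ∀ t ∈ champFini n (outerSkolem A), ∀ z ∈ termVars t, z ∉ {x | x ∈ A.boundVars} := by
    intro t ht z hz hzb
    have h := ht.2.1 hz
    rw [hsk] at h
    obtain h | ⟨z', hz', h⟩ := mem_freeVars_skolemWith hnd (fun _ _ => rfl) h
    · cases h
    · obtain rfl : z = z' := h
      exact hbf z hzb hz'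
  have hB' := hB
  rw [hsk] at hB'
  obtain ⟨a, ν, ha, hd, hν, ho, hq⟩ := exists_annotation (hsk ▸ hT) hnd hbf (fun _ h => h)
    (σ := .var) (ν := .orig) (fun _ _ => rfl) (fun _ => rfl) (fun _ => rfl)
    (fun x _ => ⟨List.not_mem_nil, rfl, rfl, fun z hz h => hz h.symm⟩) hB'
  have hflat := ha.flat_bind
  rw [readVar_var, Fml.bind_var, Fml.bind_var] at hflat
  refine ⟨ht.read, a.forget true, A.name ν, ?_, ?_, ?_, ?_⟩
  · rw [← hflat]
    -- The invariant holds at the end of the quantification phase: free variables there are ordinary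
    -- ones, while the δ-variables are Skolem terms.
    refine ha.wellFormed.quantification ha.nodup fun y hy h => ?_
    obtain ⟨z, -, e⟩ := ha.freeVars_subset h
    obtain ⟨y', -, k, ts, rfl, -⟩ := hd y hy
    cases e
  · exact ha.simplification.lift id fun _ _ h => h.gammaSimplification
  · intro C y H e
    exact skolem_of_name_eq_fill hq (p := true) (by simpa using e)
  · rw [Fml.read_lift]
    refine (polarRename_name (p := true) hnd hν (fun _ => rfl) ?_ fun z hz => ?_).lift id
      fun _ _ h => h.renameDelta
    · exact hq.imp (fun _ _ h => h) fun _ _ _ => trivial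
    · exact ho z fun h => hbf z h hz

end Skolemization

end Herbrand

theorem mainTheorem3 {L : FirstOrder.Language.{u, v}} {V : Type w} (A : Herbrand.Fml L V)
    (hA : A.Rectified) (n : ℕ) (hn : 0 < n) (hC : Herbrand.PropertyC n A) :
    (∃ B, Herbrand.Expansion (Herbrand.champFini n (Herbrand.outerSkolem A))
        (Herbrand.outerSkolem A) B ∧ B.Tautology ∧ Herbrand.HasLinearDerivation B A) ∧
    (∀ B, Herbrand.SubExpansion (Herbrand.champFini n (Herbrand.outerSkolem A))
        (Herbrand.outerSkolem A) B → B.Tautology → Herbrand.HasLinearDerivation B A) := by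
  refine ⟨?_, fun B => Herbrand.hasLinearDerivation_of_subExpansion hA⟩
  obtain ⟨B, hB, ht⟩ := hC
  exact ⟨B, hB, ht, Herbrand.hasLinearDerivation_of_subExpansion hA
    (hB.mono fun _ => subset_of_eq) ht⟩
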